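/- Let $\mathbb F$ be a finite field and $n\ge 1$; indices are taken in $\mathbb Z_n=\mathbb Z/n\mathbb Z$. A (linear tail-biting) trellis $T$ of length $n$ consists of finite-dimensional $\mathbb F$-vector spaces $\mathcal S_i$ (state spaces) and subspaces $\mathcal C_i\subseteq \mathcal S_i\times\mathbb F\times\mathcal S_{i+1}$ (constraint codes, whose elements are called branches), $i\in\mathbb Z_n$. A valid trajectory is a pair $(\mathbf a,\mathbf s)\in\mathbb F^n\times\prod_i\mathcal S_i$ with $(s_i,a_i,s_{i+1})\in\mathcal C_i$ for all $i$; the code realized by $T$ is the set of all $\mathbf a$ occurring in a valid trajectory. The dual trellis $T^\circ$ has state spaces $\hat{\mathcal S}_i=\mathrm{Hom}(\mathcal S_i,\mathbb F)$ and constraint codes $\{(g,b,h)\in\hat{\mathcal S}_i\times\mathbb F\times\hat{\mathcal S}_{i+1} : g(s)+ba-h(s')=0 \text{ for all } (s,a,s')\in\mathcal C_i\}$. $T$ is *state-trim* (*branch-trim*) if every state (every branch) lies on a valid trajectory; *proper* if no $\mathcal C_i$ contains a nonzero branch of the form $(s,0,0)$ or $(0,0,s')$; *span-two-observable* if it contains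 no path of length $n-2$ (that is, $s_i,\dots,s_{i+n-2}$ with $(s_j,a_j,s_{j+1})\in\mathcal C_j$ for $j=i,\dots,i+n-3$) with all symbols $a_j=0$ and not all states zero; *span-two-controllable* if $T^\circ$ is span-two-observable. Two trellises are isomorphic if they coincide up to isomorphisms of the state spaces. A *local reduction* of $T$ at time $i$ is a replacement of $\mathcal S_i$, $\mathcal C_{i-1}$ and $\mathcal C_i$ by spaces of at most the same respective dimensions, all other spaces being unchanged, such that the resulting trellis realizes the same code; it is *strict* if $\dim\mathcal S_i$ strictly decreases. $T$ is *locally irreducible* if each local reduction of $T$ is isomorphic to $T$, and *locally reducible* otherwise. **Theorem.** Let $\mathcal C\subseteq\mathbb F^n$ be a linear code such that neither $\mathcal C$ nor $\mathcal C^\perp$ contains a nonzero codeword supported on a circular interval of length at most $2$, and let $T$ be a trellis realizing $\mathcal C$. Then the following are equivalent: (i) $T$ is locally irreducible; (ii) $T$ is state-trim, branch-trim, proper, span-two-observable and span-two-controllable; (iii) $T^\circ$ is locally irreducible; (iv) $T^\circ$ is state-trim, branch-trim, proper, span-two-observable and span-two-controllable. Furthermore, if $T$ is locally reducible, then at least one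 of the following holds: there is a strict local reduction $T'$ of $T$, at some time $i$, such that $T'^\circ$ is a strict local reduction of $T^\circ$ at time $i$; or there are a local reduction $T'$ of $T$ at some time $i$ and a strict local reduction $T''$ of $T'$ at some time $j$ such that $T'^\circ$ is a local reduction of $T^\circ$ at time $i$ and $T''^\circ$ is a strict local reduction of $T'^\circ$ at time $j$. -/

import Mathlib

universe u

/-- A linear tail-biting trellis realization of length `n` over the field `F`, with all symbol
alphabets equal to `F` and time axis `ZMod n`: finite-dimensional state spaces `S i` and
constraint codes `C i ⊆ S i × F × S (i + 1)`. -/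
structure Trellis (F : Type u) [Field F] (n : ℕ) where
  /-- the state spaces -/
  S : ZMod n → Type u
  [instAddCommGroup : ∀ i, AddCommGroup (S i)]
  [instModule : ∀ i, Module F (S i)]
  [instFiniteDimensional : ∀ i, FiniteDimensional F (S i)]
  /-- the constraint codes; their elements are the branches -/
  C : ∀ i, Submodule F (S i × F × S (i + 1))

attribute [instance] Trellis.instAddCommGroup Trellis.instModule Trellis.instFiniteDimensional

/-- The orthogonal code with respect to the standard inner product. -/
def dualCode {F : Type u} [Field F] {n : ℕ} [NeZero n] (C : Submodule F (ZMod n → F)) :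
    Submodule F (ZMod n → F) where
  carrier := {y | ∀ x ∈ C, ∑ i, x i * y i = 0}
  zero_mem' := by simp
  add_mem' := by
    intro y z hy hz x hx
    simp [mul_add, Finset.sum_add_distrib, hy x hx, hz x hx]
  smul_mem' := by
    intro r y hy x hx
    have h : ∀ i, x i * (r • y) i = r * (x i * y i) := fun i => by
      simp only [Pi.smul_apply, smul_eq_mul]; ring
    simp only [h, ← Finset.mul_sum, hy x hx, mul_zero]

/-- The circular interval `{i, i + 1, …, i + ℓ - 1}` of length `ℓ` in `ZMod n`. -/
def circularInterval {n : ℕ} (i : ZMod n) (ℓ : ℕ) : Set (ZMod n) :=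
  {j | ∃ k : ℕ, k < ℓ ∧ j = i + (k : ZMod n)}

/-- No nonzero codeword is supported on a circular interval of length at most `2`. -/
def NoSpanTwoCodeword {F : Type u} [Field F] {n : ℕ} (C : Submodule F (ZMod n → F)) : Prop :=
  ∀ c ∈ C, ∀ (i : ZMod n) (ℓ : ℕ), ℓ ≤ 2 → Function.support c ⊆ circularInterval i ℓ → c = 0

namespace Trellis

variable {F : Type u} [Field F] {n : ℕ}

/-- The behavior: all pairs of a symbol sequence and a state sequence satisfying all constraints
(the valid trajectories). -/
def behavior (T : Trellis F n) : Submodule F ((ZMod n → F) × (∀ i, T.S i)) where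
  carrier := {p | ∀ i, (p.2 i, p.1 i, p.2 (i + 1)) ∈ T.C i}
  zero_mem' := fun i => (T.C i).zero_mem
  add_mem' := fun hp hq i => (T.C i).add_mem (hp i) (hq i)
  smul_mem' := fun r _ hp i => (T.C i).smul_mem r (hp i)

/-- The code generated (realized) by the trellis. -/
def code (T : Trellis F n) : Submodule F (ZMod n → F) :=
  T.behavior.map (LinearMap.fst F (ZMod n → F) (∀ i, T.S i))

/-- Each state appears on a valid trajectory. -/
def IsStateTrim (T : Trellis F n) : Prop :=
  ∀ (i : ZMod n) (s : T.S i), ∃ p ∈ T.behavior, p.2 i = s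

/-- Each branch appears on a valid trajectory. -/
def IsBranchTrim (T : Trellis F n) : Prop :=
  ∀ (i : ZMod n), ∀ b ∈ T.C i, ∃ p ∈ T.behavior, (p.2 i, p.1 i, p.2 (i + 1)) = b

/-- No constraint code has a nonzero branch of the form `(s, 0, 0)` or `(0, 0, s')`. -/
def IsProper (T : Trellis F n) : Prop :=
  ∀ i : ZMod n, (∀ s : T.S i, (s, (0 : F), (0 : T.S (i + 1))) ∈ T.C i → s = 0) ∧
    (∀ s' : T.S (i + 1), ((0 : T.S i), (0 : F), s') ∈ T.C i → s' = 0)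

/-- The states `s i, s (i + 1), …, s (i + ℓ)` and the symbols `a i, …, a (i + ℓ - 1)` form a path
of length `ℓ` starting at time `i`. It is used for `ℓ < n` only, so that the times visited are
distinct and a path is a restriction of sequences `s`, `a` on the whole time axis; the values of
`s` and `a` at other times play no role. -/
def IsPath (T : Trellis F n) (i : ZMod n) (ℓ : ℕ) (a : ZMod n → F) (s : ∀ j, T.S j) : Prop :=
  ∀ k : ℕ, k < ℓ →
    (s (i + (k : ZMod n)), a (i + (k : ZMod n)), s (i + (k : ZMod n) + 1)) ∈
      T.C (i + (k : ZMod n))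

/-- There is no nontrivial path of length `n - 2` representing the zero word. -/
def IsSpanTwoObservable (T : Trellis F n) : Prop :=
  ∀ (i : ZMod n) (s : ∀ j, T.S j), T.IsPath i (n - 2) 0 s →
    ∀ k : ℕ, k ≤ n - 2 → s (i + (k : ZMod n)) = 0

/-- The dual trellis `T°`: state spaces are replaced by their dual spaces, constraint codes by
their orthogonal spaces, and the sign of each dual state variable is inverted in the constraint
in which it is the end state. The symbol space `F` is identified with its dual. -/
def dual (T : Trellis F n) : Trellis F n where
  S := fun i => Module.Dual F (T.S i)
  C := fun i =>
    { carrier := {y | ∀ x ∈ T.C i, y.1 x.1 + y.2.1 * x.2.1 - y.2.2 x.2.2 = 0}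
      zero_mem' := by simp
      add_mem' := by
        intro y z hy hz x hx
        have h1 := hy x hx
        have h2 := hz x hx
        simp only [Prod.fst_add, Prod.snd_add, LinearMap.add_apply]
        linear_combination h1 + h2
      smul_mem' := by
        intro r y hy x hx
        have h1 := hy x hx
        simp only [Prod.smul_fst, Prod.smul_snd, LinearMap.smul_apply, smul_eq_mul]
        linear_combination r * h1 }

/-- The dual trellis is span-two-observable. -/
def IsSpanTwoControllable (T : Trellis F n) : Prop :=
  T.dual.IsSpanTwoObservable

/-- Two trellises coincide up to state space isomorphisms. -/
def IsIsomorphic (T T' : Trellis F n) : Prop :=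
  ∃ φ : ∀ i, T.S i ≃ₗ[F] T'.S i, ∀ i,
    T'.C i = (T.C i).map ((φ i).prodCongr
      ((LinearEquiv.refl F F).prodCongr (φ (i + 1)))).toLinearMap

/-- `T'` is a local reduction of `T` at time `i`: the state space at time `i` and the incident
constraint codes at times `i - 1` and `i` are replaced by spaces of at most the same dimension,
all other state spaces and constraint codes are unchanged (they are identified through linear
isomorphisms `e j`, `j ≠ i`), and the code realized is the same. -/
def IsLocalReductionAt (i : ZMod n) (T T' : Trellis F n) : Prop :=
  Module.finrank F (T'.S i) ≤ Module.finrank F (T.S i) ∧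
  Module.finrank F (T'.C (i - 1)) ≤ Module.finrank F (T.C (i - 1)) ∧
  Module.finrank F (T'.C i) ≤ Module.finrank F (T.C i) ∧
  (∃ e : ∀ j, j ≠ i → (T.S j ≃ₗ[F] T'.S j), ∀ (j : ZMod n) (h : j ≠ i) (h' : j + 1 ≠ i),
    T'.C j = (T.C j).map ((e j h).prodCongr
      ((LinearEquiv.refl F F).prodCongr (e (j + 1) h'))).toLinearMap) ∧
  T'.code = T.code

/-- A local reduction at time `i` that strictly reduces the state space dimension. -/
def IsStrictLocalReductionAt (i : ZMod n) (T T' : Trellis F n) : Prop :=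
  IsLocalReductionAt i T T' ∧ Module.finrank F (T'.S i) < Module.finrank F (T.S i)

/-- Each local reduction is isomorphic to the original trellis. -/
def IsLocallyIrreducible (T : Trellis F n) : Prop :=
  ∀ (i : ZMod n) (T' : Trellis F n), IsLocalReductionAt i T T' → IsIsomorphic T T'

end Trellis

/-! The core claim is that local irreducibility is the same as span-two-observability together with
span-two-controllability. Dualizing swaps these two properties because a trellis is isomorphic to
its double dual. The hypotheses on the code force `3 ≤ n`, and then the two properties imply
trimness and properness, so all four conditions agree.

Sufficiency: controllability joins any state at time `m + 2` to any state at time `m` by a path of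
length `n - 2`, and observability makes such a path unique given its symbols. A reduction at time `m
+ 1` with the same code must therefore keep the composite of the two constraint codes it changes
(`exists_state_iff_of_localReduction`). That composite is a two-stage relation that is trim and
proper in the middle, so it determines its middle space up to isomorphism
(`Submodule.exists_equiv_of_comp_eq`).

Necessity: if `T` or its dual is not state-trim, discarding the useless states is a strict reduction
of both. Otherwise suppose `T` has a nonzero zero-symbol path `z` from `m + 2` to `m`, and set `z (m
+ 1) = 0`. Replacing states `s j` by `s j - φ (s (m + 1)) • z j` changes only the two constraint
codes at `m + 1` and keeps the code. Unless `z` closes up to a codeword supported on `{m, m + 1}`, a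
suitable `φ` destroys trimness of the new trellis or of its dual, and a strict reduction follows.
The uncontrollable case is dual. Every constraint code used is a preimage under an injective map, so
dimensions drop on both sides of the duality. -/

/-! ### Dual constraint codes and the code of the dual trellis -/

/-- The identification of `V* × F × W*` with `(V × F × W)*` for the pairing that defines the dual
constraint codes. -/
def branchPairing (F : Type*) [Field F] (V W : Type*) [AddCommGroup V] [Module F V]
    [AddCommGroup W] [Module F W] :
    (Module.Dual F V × F × Module.Dual F W) ≃ₗ[F] Module.Dual F (V × F × W) where
  toFun y :=
    { toFun := fun x => y.1 x.1 + y.2.1 * x.2.1 - y.2.2 x.2.2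
      map_add' := fun x x' => by simp; ring
      map_smul' := fun r x => by simp; ring }
  map_add' y y' := LinearMap.ext fun x => by simp; ring
  map_smul' r y := LinearMap.ext fun x => by simp; ring
  invFun ω :=
    (ω ∘ₗ LinearMap.inl F V (F × W), ω (0, 1, 0),
      -(ω ∘ₗ LinearMap.inr F V (F × W) ∘ₗ LinearMap.inr F F W))
  left_inv y := by
    refine Prod.ext ?_ (Prod.ext ?_ ?_)
    · ext; simp
    · simp
    · ext; simp
  right_inv ω := by
    have h1 : ω (0, 0, 0) = 0 := map_zero ω
    have h2 : ω (0, 0) = 0 := map_zero ω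
    ext <;> simp [h1, h2]

@[simp]
theorem branchPairing_apply {F : Type*} [Field F] {V W : Type*} [AddCommGroup V] [Module F V]
    [AddCommGroup W] [Module F W] (y : Module.Dual F V × F × Module.Dual F W) (x : V × F × W) :
    branchPairing F V W y x = y.1 x.1 + y.2.1 * x.2.1 - y.2.2 x.2.2 :=
  rfl

namespace Trellis

variable {F : Type u} [Field F] {n : ℕ}

theorem mem_code {T : Trellis F n} {a : ZMod n → F} :
    a ∈ T.code ↔ ∃ s : ∀ i, T.S i, ∀ i, (s i, a i, s (i + 1)) ∈ T.C i := by
  constructor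
  · rintro ⟨⟨a, s⟩, h, rfl⟩
    exact ⟨s, h⟩
  · rintro ⟨s, h⟩
    exact ⟨(a, s), h, rfl⟩

theorem mem_dual_C {T : Trellis F n} {j : ZMod n} {g : Module.Dual F (T.S j)} {b : F}
    {h : Module.Dual F (T.S (j + 1))} :
    (g, b, h) ∈ T.dual.C j ↔ ∀ s a s', (s, a, s') ∈ T.C j → g s + b * a - h s' = 0 :=
  ⟨fun H s a s' hx => H (s, a, s') hx, fun H x hx => H x.1 x.2.1 x.2.2 hx⟩

theorem finrank_dual_S (T : Trellis F n) (j : ZMod n) :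
    Module.finrank F (T.dual.S j) = Module.finrank F (T.S j) :=
  Subspace.dual_finrank_eq

theorem finrank_dual_C (T : Trellis F n) (j : ZMod n) :
    Module.finrank F (T.dual.C j) + Module.finrank F (T.C j) =
      Module.finrank F (T.S j) + 1 + Module.finrank F (T.S (j + 1)) := by
  have h1 : Module.finrank F (T.dual.C j) = Module.finrank F (T.C j).dualAnnihilator := by
    let e : (T.dual.S j × F × T.dual.S (j + 1)) ≃ₗ[F] Module.Dual F (T.S j × F × T.S (j + 1)) :=
      branchPairing F (T.S j) (T.S (j + 1))
    have h : T.dual.C j = (T.C j).dualAnnihilator.comap e.toLinearMap := by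
      ext y
      rw [Submodule.mem_comap, Submodule.mem_dualAnnihilator]
      rfl
    rw [h]
    exact LinearEquiv.finrank_eq (LinearEquiv.ofSubmodule' e (T.C j).dualAnnihilator)
  have h2 := Subspace.finrank_add_finrank_dualAnnihilator_eq (T.C j)
  rw [Module.finrank_prod, Module.finrank_prod, Module.finrank_self] at h2
  omega

/-- A linear functional vanishing on the behavior is a sum of branches of the dual trellis. -/
theorem exists_dual_branches [NeZero n] (T : Trellis F n)
    (l : Module.Dual F ((ZMod n → F) × (∀ j, T.S j))) (hl : ∀ p ∈ T.behavior, l p = 0) :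
    ∃ (g : ∀ j, Module.Dual F (T.S j)) (b : ZMod n → F) (h : ∀ j, Module.Dual F (T.S (j + 1))),
      (∀ j, (g j, b j, h j) ∈ T.dual.C j) ∧
      ∀ a s, l (a, s) = ∑ j, (g j (s j) + b j * a j - h j (s (j + 1))) := by
  -- The behavior is the kernel of `W`, so a functional vanishing on it factors through `W`. The
  -- components of the factor on the quotients are the dual branches.
  let W : ((ZMod n → F) × (∀ j, T.S j)) →ₗ[F] ∀ j, ((T.S j × F × T.S (j + 1)) ⧸ T.C j) :=
    LinearMap.pi fun j => (T.C j).mkQ ∘ₗ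
      ((LinearMap.proj j ∘ₗ LinearMap.snd F _ _).prod
        ((LinearMap.proj j ∘ₗ LinearMap.fst F _ _).prod
          (LinearMap.proj (j + 1) ∘ₗ LinearMap.snd F _ _)))
  have hW : ∀ p j, W p j = (T.C j).mkQ (p.2 j, p.1 j, p.2 (j + 1)) := fun p j => rfl
  have hmem : l ∈ (LinearMap.ker W).dualAnnihilator := by
    rw [Submodule.mem_dualAnnihilator]
    intro p hp
    refine hl p fun j => ?_
    have := congrFun (LinearMap.mem_ker.1 hp) j
    rw [hW] at this
    simpa using this
  rw [← LinearMap.range_dualMap_eq_dualAnnihilator_ker] at hmem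
  obtain ⟨L, rfl⟩ := hmem
  let y : ∀ j, Module.Dual F (T.S j) × F × Module.Dual F (T.S (j + 1)) := fun j =>
    (branchPairing F (T.S j) (T.S (j + 1))).symm
      (L ∘ₗ LinearMap.single F (fun j => (T.S j × F × T.S (j + 1)) ⧸ T.C j) j ∘ₗ (T.C j).mkQ)
  have hy : ∀ j x, (y j).1 x.1 + (y j).2.1 * x.2.1 - (y j).2.2 x.2.2 =
      L (Pi.single j ((T.C j).mkQ x)) := by
    intro j x
    rw [← branchPairing_apply, LinearEquiv.apply_symm_apply]
    rfl
  refine ⟨fun j => (y j).1, fun j => (y j).2.1, fun j => (y j).2.2, fun j => ?_, fun a s => ?_⟩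
  · intro x hx
    refine (hy j x).trans ?_
    have : (T.C j).mkQ x = 0 := by simpa using hx
    rw [this, Pi.single_zero, map_zero]
  · rw [LinearMap.dualMap_apply]
    conv_lhs => rw [← Finset.univ_sum_single (W (a, s))]
    rw [map_sum]
    refine Finset.sum_congr rfl fun j _ => ?_
    rw [hy j (s j, a j, s (j + 1)), hW]

theorem sum_dual_branches_single [NeZero n] {T : Trellis F n} (g : ∀ j, Module.Dual F (T.S j))
    (b : ZMod n → F) (h : ∀ j, Module.Dual F (T.S (j + 1))) (j : ZMod n) (x : T.S (j + 1)) :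
    ∑ k, (g k ((Pi.single (j + 1) x : ∀ i, T.S i) k) + b k * (0 : ZMod n → F) k
      - h k ((Pi.single (j + 1) x : ∀ i, T.S i) (k + 1))) = g (j + 1) x - h j x := by
  simp only [Pi.zero_apply, mul_zero, add_zero, Finset.sum_sub_distrib]
  congr 1
  · rw [Finset.sum_eq_single (j + 1)]
    · simp
    · intro k _ hk
      rw [Pi.single_eq_of_ne hk, map_zero]
    · simp
  · rw [Finset.sum_eq_single j]
    · simp
    · intro k _ hk
      rw [Pi.single_eq_of_ne (fun e => hk (add_right_cancel e)), map_zero]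
    · simp

theorem sum_dual_branches_symbol [NeZero n] {T : Trellis F n} (g : ∀ j, Module.Dual F (T.S j))
    (b : ZMod n → F) (h : ∀ j, Module.Dual F (T.S (j + 1))) (j : ZMod n) :
    ∑ k, (g k ((0 : ∀ i, T.S i) k) + b k * (Pi.single j 1 : ZMod n → F) k
      - h k ((0 : ∀ i, T.S i) (k + 1))) = b j := by
  rw [Finset.sum_eq_single j]
  · simp
  · intro k _ hk
    simp [Pi.single_eq_of_ne hk]
  · simp

theorem sum_shift_sub_eq_zero [NeZero n] (f : ZMod n → F) : ∑ j, (f j - f (j + 1)) = 0 := by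
  rw [Finset.sum_sub_distrib, sub_eq_zero]
  exact (Equiv.sum_comp (Equiv.addRight (1 : ZMod n)) f).symm

/-- The code realized by the dual trellis is the dual code. -/
theorem code_dual [NeZero n] (T : Trellis F n) : T.dual.code = dualCode T.code := by
  ext b
  constructor
  · intro hb a ha
    obtain ⟨g, hg⟩ := mem_code.1 hb
    obtain ⟨s, hs⟩ := mem_code.1 ha
    change ∀ j, Module.Dual F (T.S j) at g
    have h1 : ∀ j, g j (s j) + b j * a j - g (j + 1) (s (j + 1)) = 0 := fun j =>
      mem_dual_C.1 (hg j) _ _ _ (hs j)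
    have h2 : ∀ j, a j * b j = -(g j (s j) - g (j + 1) (s (j + 1))) := fun j => by
      linear_combination h1 j
    rw [Finset.sum_congr rfl fun j _ => h2 j, Finset.sum_neg_distrib,
      sum_shift_sub_eq_zero fun j => g j (s j), neg_zero]
  · intro hb
    let l : Module.Dual F ((ZMod n → F) × (∀ j, T.S j)) :=
      (∑ j, b j • (LinearMap.proj j : (ZMod n → F) →ₗ[F] F)) ∘ₗ LinearMap.fst F _ _
    have hl : ∀ a s, l (a, s) = ∑ j, a j * b j := by
      intro a s
      simp [l, mul_comm]
    obtain ⟨g, c, h, hy, hsum⟩ := T.exists_dual_branches l fun p hp =>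
      (hl p.1 p.2).trans (hb p.1 ⟨p, hp, rfl⟩)
    -- Testing on single symbols identifies the dual symbols. Testing on single states shows that
    -- consecutive dual branches fit together.
    have hc : ∀ j, c j = b j := by
      intro j
      rw [← sum_dual_branches_symbol g c h j, ← hsum, hl]
      simp [Pi.single_apply]
    have hgh : ∀ j, h j = g (j + 1) := by
      intro j
      ext x
      have := sum_dual_branches_single g c h j x
      rw [← hsum, hl] at this
      simp only [Pi.zero_apply, zero_mul, Finset.sum_const_zero] at this
      exact (sub_eq_zero.1 this.symm).symm
    refine mem_code.2 ⟨g, fun j => ?_⟩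
    have := hy j
    rw [hc, hgh] at this
    exact this

end Trellis

/-! ### Isomorphisms, local reductions and biduality -/

theorem Submodule.eq_map_branch_iff {F V V' W W' : Type*} [Field F]
    [AddCommGroup V] [Module F V] [AddCommGroup V'] [Module F V']
    [AddCommGroup W] [Module F W] [AddCommGroup W'] [Module F W']
    {C : Submodule F (V × F × W)} {C' : Submodule F (V' × F × W')}
    {e : V ≃ₗ[F] V'} {f : W ≃ₗ[F] W'} :
    C' = C.map (e.prodCongr ((LinearEquiv.refl F F).prodCongr f)).toLinearMap ↔
      ∀ s a s', (s, a, s') ∈ C ↔ (e s, a, f s') ∈ C' := by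
  constructor
  · rintro rfl s a s'
    rw [Submodule.mem_map_equiv]
    simp
  · intro h
    ext ⟨s, a, s'⟩
    rw [Submodule.mem_map_equiv]
    have := h (e.symm s) a (f.symm s')
    rw [e.apply_symm_apply, f.apply_symm_apply] at this
    exact this.symm

namespace Trellis

variable {F : Type u} [Field F] {n : ℕ}

theorem isIsomorphic_iff {T T' : Trellis F n} :
    IsIsomorphic T T' ↔ ∃ φ : ∀ i, T.S i ≃ₗ[F] T'.S i, ∀ i s a s',
      (s, a, s') ∈ T.C i ↔ (φ i s, a, φ (i + 1) s') ∈ T'.C i :=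
  exists_congr fun _ => forall_congr' fun _ => Submodule.eq_map_branch_iff

theorem isLocalReductionAt_iff {i : ZMod n} {T T' : Trellis F n} :
    IsLocalReductionAt i T T' ↔
      Module.finrank F (T'.S i) ≤ Module.finrank F (T.S i) ∧
      Module.finrank F (T'.C (i - 1)) ≤ Module.finrank F (T.C (i - 1)) ∧
      Module.finrank F (T'.C i) ≤ Module.finrank F (T.C i) ∧
      (∃ e : ∀ j, j ≠ i → (T.S j ≃ₗ[F] T'.S j), ∀ (j : ZMod n) (h : j ≠ i) (h' : j + 1 ≠ i),
        ∀ s a s', (s, a, s') ∈ T.C j ↔ (e j h s, a, e (j + 1) h' s') ∈ T'.C j) ∧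
      T'.code = T.code := by
  unfold IsLocalReductionAt
  simp only [Submodule.eq_map_branch_iff]

theorem IsIsomorphic.refl (T : Trellis F n) : IsIsomorphic T T :=
  isIsomorphic_iff.2 ⟨fun _ => LinearEquiv.refl F _, fun _ _ _ _ => Iff.rfl⟩

theorem IsIsomorphic.symm {T T' : Trellis F n} (h : IsIsomorphic T T') : IsIsomorphic T' T := by
  obtain ⟨φ, hφ⟩ := isIsomorphic_iff.1 h
  refine isIsomorphic_iff.2 ⟨fun i => (φ i).symm, fun i s a s' => ?_⟩
  rw [hφ, LinearEquiv.apply_symm_apply, LinearEquiv.apply_symm_apply]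

theorem IsIsomorphic.code_le {T T' : Trellis F n} (h : IsIsomorphic T T') : T.code ≤ T'.code := by
  obtain ⟨φ, hφ⟩ := isIsomorphic_iff.1 h
  intro a ha
  obtain ⟨s, hs⟩ := mem_code.1 ha
  exact mem_code.2 ⟨fun i => φ i (s i), fun i => (hφ i _ _ _).1 (hs i)⟩

theorem IsIsomorphic.code_eq {T T' : Trellis F n} (h : IsIsomorphic T T') : T.code = T'.code :=
  le_antisymm h.code_le h.symm.code_le

theorem IsIsomorphic.finrank_S {T T' : Trellis F n} (h : IsIsomorphic T T') (i : ZMod n) :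
    Module.finrank F (T.S i) = Module.finrank F (T'.S i) :=
  let ⟨φ, _⟩ := h
  (φ i).finrank_eq

theorem IsIsomorphic.finrank_C {T T' : Trellis F n} (h : IsIsomorphic T T') (i : ZMod n) :
    Module.finrank F (T.C i) = Module.finrank F (T'.C i) := by
  obtain ⟨φ, hφ⟩ := h
  rw [hφ i]
  exact (LinearEquiv.finrank_map_eq _ _).symm

theorem IsLocalReductionAt.congr {i : ZMod n} {T₀ T₁ T₂ T₃ : Trellis F n}
    (h : IsLocalReductionAt i T₁ T₂) (h₀ : IsIsomorphic T₀ T₁) (h₃ : IsIsomorphic T₂ T₃) :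
    IsLocalReductionAt i T₀ T₃ := by
  obtain ⟨hS, hC, hC', ⟨e, he⟩, hcode⟩ := isLocalReductionAt_iff.1 h
  rw [isLocalReductionAt_iff]
  rw [← h₀.finrank_S, h₃.finrank_S] at hS
  rw [← h₀.finrank_C, h₃.finrank_C] at hC hC'
  refine ⟨hS, hC, hC', ?_, h₃.code_eq.symm.trans (hcode.trans h₀.code_eq.symm)⟩
  obtain ⟨φ, hφ⟩ := isIsomorphic_iff.1 h₀
  obtain ⟨ψ, hψ⟩ := isIsomorphic_iff.1 h₃
  refine ⟨fun j hj => (φ j).trans ((e j hj).trans (ψ j)), fun j hj hj' s a s' => ?_⟩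
  rw [hφ, he j hj hj', hψ]
  rfl

theorem IsStrictLocalReductionAt.congr {i : ZMod n} {T₀ T₁ T₂ T₃ : Trellis F n}
    (h : IsStrictLocalReductionAt i T₁ T₂) (h₀ : IsIsomorphic T₀ T₁) (h₃ : IsIsomorphic T₂ T₃) :
    IsStrictLocalReductionAt i T₀ T₃ := by
  refine ⟨h.1.congr h₀ h₃, ?_⟩
  rw [h₀.finrank_S, ← h₃.finrank_S]
  exact h.2

/-- A constraint code is its own double annihilator, and evaluation carries the sign of the end
state along correctly. -/
theorem isIsomorphic_dual_dual (T : Trellis F n) : IsIsomorphic T T.dual.dual := by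
  refine isIsomorphic_iff.2 ⟨fun i => Module.evalEquiv F (T.S i), fun i s a s' => ?_⟩
  constructor
  · intro hx y hy
    obtain ⟨g, b, k⟩ := y
    change Module.Dual F (T.S i) at g
    change Module.Dual F (T.S (i + 1)) at k
    have := mem_dual_C.1 hy _ _ _ hx
    rw [mul_comm] at this
    exact this
  · intro h
    rw [← Subspace.forall_mem_dualAnnihilator_apply_eq_zero_iff]
    intro ω hω
    obtain ⟨⟨g, b, k⟩, rfl⟩ := (branchPairing F (T.S i) (T.S (i + 1))).surjective ω
    have hy : (g, b, k) ∈ T.dual.C i := fun x hx => (Submodule.mem_dualAnnihilator _).1 hω x hx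
    have h1 : g s + a * b - k s' = 0 := h _ hy
    rw [branchPairing_apply, mul_comm]
    exact h1

theorem IsLocalReductionAt.dual [NeZero n] {i : ZMod n} {T T' : Trellis F n}
    (h : IsLocalReductionAt i T T')
    (h₁ : Module.finrank F (T'.dual.C (i - 1)) ≤ Module.finrank F (T.dual.C (i - 1)))
    (h₂ : Module.finrank F (T'.dual.C i) ≤ Module.finrank F (T.dual.C i)) :
    IsLocalReductionAt i T.dual T'.dual := by
  obtain ⟨hS, -, -, ⟨e, he⟩, hcode⟩ := isLocalReductionAt_iff.1 h
  refine isLocalReductionAt_iff.2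
    ⟨by rwa [finrank_dual_S, finrank_dual_S], h₁, h₂, ?_, by rw [code_dual, code_dual, hcode]⟩
  refine ⟨fun j hj => (e j hj).symm.dualMap, fun j hj hj' g b k => ?_⟩
  change Module.Dual F (T.S j) at g
  change Module.Dual F (T.S (j + 1)) at k
  change (g, b, k) ∈ T.dual.C j ↔
    ((e j hj).symm.dualMap g, b, (e (j + 1) hj').symm.dualMap k) ∈ T'.dual.C j
  refine mem_dual_C.trans (Iff.trans ?_ mem_dual_C.symm)
  constructor
  · intro H s a s' hs
    refine H _ a _ ((he j hj hj' _ _ _).2 ?_)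
    simpa using hs
  · intro H s a s' hs
    have := H _ a _ ((he j hj hj' _ _ _).1 hs)
    simpa [LinearEquiv.dualMap_apply] using this

theorem _root_.ZMod.exists_eq_add_natCast [NeZero n] (i j : ZMod n) :
    ∃ k : ℕ, k < n ∧ j = i + (k : ZMod n) :=
  ⟨(j - i).val, ZMod.val_lt _, by rw [ZMod.natCast_zmod_val]; ring⟩

/-- A path of length `n - 2` from `m + 2` around to `m` visits every time but `m + 1`. This form
avoids counting steps. -/
theorem isSpanTwoObservable_iff [NeZero n] (hn : 2 ≤ n) {T : Trellis F n} :
    T.IsSpanTwoObservable ↔ ∀ (m : ZMod n) (s : ∀ j, T.S j),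
      (∀ j, j ≠ m → j ≠ m + 1 → (s j, (0 : F), s (j + 1)) ∈ T.C j) →
        ∀ j, j ≠ m + 1 → s j = 0 := by
  have hn2 : ((n - 2 : ℕ) : ZMod n) = -2 := by
    rw [Nat.cast_sub hn]
    simp
  have hcast : ∀ k : ℕ, k < n → ((k : ZMod n) = -2 → k = n - 2) ∧
      ((k : ZMod n) = -1 → k = n - 1) := by
    intro k hk
    constructor
    · intro h
      rw [← hn2, ZMod.natCast_eq_natCast_iff', Nat.mod_eq_of_lt hk,
        Nat.mod_eq_of_lt (by omega)] at h
      exact h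
    · intro h
      have h' : ((k : ℕ) : ZMod n) = ((n - 1 : ℕ) : ZMod n) := by
        rw [h, Nat.cast_sub (by omega)]
        simp
      rw [ZMod.natCast_eq_natCast_iff', Nat.mod_eq_of_lt hk, Nat.mod_eq_of_lt (by omega)] at h'
      exact h'
  constructor
  · intro H m s hs j hj
    obtain ⟨k, hk, rfl⟩ := ZMod.exists_eq_add_natCast (m + 2) j
    refine H (m + 2) s ?_ k ?_
    · intro k hk
      refine hs _ (fun h => ?_) (fun h => ?_)
      · have := (hcast k (by omega)).1 (by linear_combination h)
        omega
      · have := (hcast k (by omega)).2 (by linear_combination h)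
        omega
    · by_contra hk'
      apply hj
      have : k = n - 1 := by omega
      rw [this, Nat.cast_sub (by omega)]
      simp
      ring
  · intro H i s hs k hk
    refine H (i - 2) s ?_ _ ?_
    · intro j hj hj'
      obtain ⟨k, hk, rfl⟩ := ZMod.exists_eq_add_natCast i j
      refine hs k ?_
      by_contra hk'
      have : k = n - 2 ∨ k = n - 1 := by omega
      rcases this with rfl | rfl
      · exact hj (by rw [hn2]; ring)
      · apply hj'
        rw [Nat.cast_sub (by omega)]
        simp
        ring
    · intro h
      have := (hcast k (by omega)).2 (by linear_combination h)
      omega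

end Trellis

/-! ### Two kinds of reduction: trimming states and shearing along a zero path -/

theorem Submodule.finrank_add_finrank_le_finrank_comap_add {F X Y : Type*} [Field F]
    [AddCommGroup X] [Module F X] [FiniteDimensional F X]
    [AddCommGroup Y] [Module F Y] [FiniteDimensional F Y] (f : X →ₗ[F] Y) (C : Submodule F Y) :
    Module.finrank F C + Module.finrank F X ≤ Module.finrank F (C.comap f) + Module.finrank F Y := by
  have h1 := LinearMap.finrank_range_add_finrank_ker (C.mkQ ∘ₗ f)
  have h2 : LinearMap.ker (C.mkQ ∘ₗ f) = C.comap f := by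
    rw [LinearMap.ker_comp, Submodule.ker_mkQ]
  have h3 := Submodule.finrank_le (LinearMap.range (C.mkQ ∘ₗ f))
  have h4 := Submodule.finrank_quotient_add_finrank C
  rw [h2] at h1
  omega

theorem Submodule.finrank_comap_le_of_injective {F X Y : Type*} [Field F]
    [AddCommGroup X] [Module F X]
    [AddCommGroup Y] [Module F Y] [FiniteDimensional F Y] {f : X →ₗ[F] Y}
    (hf : Function.Injective f) (C : Submodule F Y) :
    Module.finrank F (C.comap f) ≤ Module.finrank F C := by
  refine LinearMap.finrank_le_finrank_of_injective
    (f := f.restrict (p := C.comap f) (q := C) fun x hx => hx) ?_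
  intro x y h
  exact Subtype.ext (hf (congrArg Subtype.val h))

theorem ZMod.add_one_ne_self {n : ℕ} (hn : 2 ≤ n) (j : ZMod n) : j + 1 ≠ j := by
  have : Fact (1 < n) := ⟨by omega⟩
  exact fun h => one_ne_zero (add_eq_left.1 h)

namespace Trellis

variable {F : Type u} [Field F] {n : ℕ}

/-- The dimension of a dual constraint code is the codimension of the constraint code, which cannot
grow under preimages. -/
theorem finrank_dual_C_le_of_eq_comap {T T' : Trellis F n} {j : ZMod n}
    {f : (T'.S j × F × T'.S (j + 1)) →ₗ[F] (T.S j × F × T.S (j + 1))}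
    (hf : T'.C j = (T.C j).comap f) :
    Module.finrank F (T'.dual.C j) ≤ Module.finrank F (T.dual.C j) := by
  have h1 := T.finrank_dual_C j
  have h2 := T'.finrank_dual_C j
  have h3 := Submodule.finrank_add_finrank_le_finrank_comap_add f (T.C j)
  rw [← hf] at h3
  simp only [Module.finrank_prod, Module.finrank_self] at h3
  omega

/-- If each constraint code of `T'` is the preimage of one of `T` under an injective linear map and
`T'` satisfies the remaining conditions of a local reduction, then `T'` and its dual are local
reductions of `T` and its dual. -/
theorem isLocalReductionAt_and_dual_of_eq_comap [NeZero n] {T T' : Trellis F n} {i : ZMod n}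
    (f : ∀ j, (T'.S j × F × T'.S (j + 1)) →ₗ[F] (T.S j × F × T.S (j + 1)))
    (hinj : ∀ j, Function.Injective (f j)) (hf : ∀ j, T'.C j = (T.C j).comap (f j))
    (hS : Module.finrank F (T'.S i) ≤ Module.finrank F (T.S i))
    (he : ∃ e : ∀ j, j ≠ i → (T.S j ≃ₗ[F] T'.S j), ∀ (j : ZMod n) (h : j ≠ i) (h' : j + 1 ≠ i),
        ∀ s a s', (s, a, s') ∈ T.C j ↔ (e j h s, a, e (j + 1) h' s') ∈ T'.C j)
    (hcode : T'.code = T.code) :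
    IsLocalReductionAt i T T' ∧ IsLocalReductionAt i T.dual T'.dual := by
  have hC : ∀ j, Module.finrank F (T'.C j) ≤ Module.finrank F (T.C j) := fun j => by
    rw [hf j]
    exact Submodule.finrank_comap_le_of_injective (hinj j) _
  have h : IsLocalReductionAt i T T' :=
    isLocalReductionAt_iff.2 ⟨hS, hC _, hC _, he, hcode⟩
  exact ⟨h, h.dual (finrank_dual_C_le_of_eq_comap (hf _)) (finrank_dual_C_le_of_eq_comap (hf _))⟩

/-- The trellis obtained by restricting the states to subspaces of the state spaces. -/
def restrictStates (T : Trellis F n) (V : ∀ j, Submodule F (T.S j)) : Trellis F n where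
  S j := V j
  C j := (T.C j).comap ((V j).subtype.prodMap (LinearMap.id.prodMap (V (j + 1)).subtype))

/-- The states at time `j` that lie on valid trajectories. -/
def trimStates (T : Trellis F n) (j : ZMod n) : Submodule F (T.S j) :=
  T.behavior.map (LinearMap.proj j ∘ₗ LinearMap.snd F (ZMod n → F) (∀ i, T.S i))

theorem isStateTrim_iff {T : Trellis F n} : T.IsStateTrim ↔ ∀ j, T.trimStates j = ⊤ :=
  forall_congr' fun j => (Submodule.eq_top_iff' (p := T.trimStates j)).symm

theorem exists_isStrictLocalReductionAt_of_not_isStateTrim [NeZero n] {T : Trellis F n}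
    (hT : ¬ T.IsStateTrim) :
    ∃ (i : ZMod n) (T' : Trellis F n),
      IsStrictLocalReductionAt i T T' ∧ IsStrictLocalReductionAt i T.dual T'.dual := by
  rw [isStateTrim_iff] at hT
  push Not at hT
  obtain ⟨i, hi⟩ := hT
  let V : ∀ j, Submodule F (T.S j) := fun j => if j = i then T.trimStates j else ⊤
  have hVi : V i = T.trimStates i := if_pos rfl
  have hV : ∀ j, j ≠ i → V j = ⊤ := fun j hj => if_neg hj
  have hlt : Module.finrank F (V i) < Module.finrank F (T.S i) := by
    rw [hVi]
    exact Submodule.finrank_lt hi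
  have key : IsLocalReductionAt i T (T.restrictStates V) ∧
      IsLocalReductionAt i T.dual (T.restrictStates V).dual := by
    refine isLocalReductionAt_and_dual_of_eq_comap
      (fun j => (V j).subtype.prodMap (LinearMap.id.prodMap (V (j + 1)).subtype)) ?_
      (fun _ => rfl) hlt.le ?_ ?_
    · intro j
      rintro ⟨s, a, s'⟩ ⟨t, b, t'⟩ h
      have h' := Prod.ext_iff.1 h
      have h'' := Prod.ext_iff.1 h'.2
      exact Prod.ext (Subtype.ext h'.1) (Prod.ext h''.1 (Subtype.ext h''.2))
    · exact ⟨fun j hj => (LinearEquiv.ofTop (V j) (hV j hj)).symm, fun j hj hj' s a s' => Iff.rfl⟩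
    · ext a
      rw [mem_code, mem_code]
      constructor
      · rintro ⟨s, hs⟩
        change ∀ j, V j at s
        exact ⟨fun j => (s j : T.S j), fun j => hs j⟩
      · rintro ⟨s, hs⟩
        have hmem : ∀ j, s j ∈ V j := by
          intro j
          by_cases hj : j = i
          · subst hj
            rw [hVi]
            exact ⟨(a, s), hs, rfl⟩
          · rw [hV j hj]
            trivial
        exact ⟨fun j => ⟨s j, hmem j⟩, fun j => hs j⟩
  refine ⟨i, T.restrictStates V, ⟨key.1, hlt⟩, key.2, ?_⟩
  rw [finrank_dual_S, finrank_dual_S]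
  exact hlt

/-- The linear map `(s, a, s') ↦ (s + φ' s' • z, a, s' + φ s • z')`. -/
def shearMap {V W : Type*} [AddCommGroup V] [Module F V] [AddCommGroup W] [Module F W]
    (φ : Module.Dual F V) (φ' : Module.Dual F W) (z : V) (z' : W) :
    (V × F × W) →ₗ[F] (V × F × W) where
  toFun x := (x.1 + φ' x.2.2 • z, x.2.1, x.2.2 + φ x.1 • z')
  map_add' x y := by
    refine Prod.ext ?_ (Prod.ext rfl ?_)
    · simp only [Prod.fst_add, Prod.snd_add, map_add, add_smul]
      abel
    · simp only [Prod.fst_add, Prod.snd_add, map_add, add_smul]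
      abel
  map_smul' r x := by
    refine Prod.ext ?_ (Prod.ext rfl ?_) <;> simp [mul_smul]

theorem shearMap_injective {V W : Type*} [AddCommGroup V] [Module F V] [AddCommGroup W]
    [Module F W] {φ : Module.Dual F V} {φ' : Module.Dual F W} {z : V} {z' : W} (h : φ z = 0) :
    Function.Injective (shearMap φ φ' z z') := by
  rw [injective_iff_map_eq_zero]
  rintro ⟨s, a, s'⟩ hx
  have h1 : s + φ' s' • z = 0 := congrArg Prod.fst hx
  have h2 : a = 0 := congrArg (fun x => x.2.1) hx
  have h3 : s' + φ s • z' = 0 := congrArg (fun x => x.2.2) hx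
  have h4 : φ s = 0 := by
    have := congrArg φ h1
    simpa [h] using this
  have h5 : s' = 0 := by simpa [h4] using h3
  have h6 : s = 0 := by simpa [h5] using h1
  rw [h2, h5, h6]
  rfl

/-- The trellis obtained by replacing each state sequence `s` by the states
`s j - φ i (s i) • z j`, if `φ` is concentrated at time `i`. -/
def shear (T : Trellis F n) (z : ∀ j, T.S j) (φ : ∀ j, Module.Dual F (T.S j)) : Trellis F n where
  S := T.S
  C j := (T.C j).comap (shearMap (φ j) (φ (j + 1)) (z j) (z (j + 1)))

theorem mem_shear_C {T : Trellis F n} {z : ∀ j, T.S j} {φ : ∀ j, Module.Dual F (T.S j)}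
    {j : ZMod n} {s : T.S j} {a : F} {s' : T.S (j + 1)} :
    (s, a, s') ∈ (T.shear z φ).C j ↔
      (s + φ (j + 1) s' • z j, a, s' + φ j s • z (j + 1)) ∈ T.C j :=
  Iff.rfl

theorem shear_isLocalReductionAt [NeZero n] (hn : 2 ≤ n) {T : Trellis F n} {i : ZMod n}
    {z : ∀ j, T.S j} {φ : ∀ j, Module.Dual F (T.S j)} (hzi : z i = 0)
    (hz : ∀ j, j ≠ i → j + 1 ≠ i → (z j, (0 : F), z (j + 1)) ∈ T.C j)
    (hφ : ∀ j, j ≠ i → φ j = 0) :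
    IsLocalReductionAt i T (T.shear z φ) ∧ IsLocalReductionAt i T.dual (T.shear z φ).dual := by
  have hφz : ∀ j, φ j (z j) = 0 := by
    intro j
    by_cases hj : j = i
    · subst hj
      rw [hzi, map_zero]
    · rw [hφ j hj, LinearMap.zero_apply]
  -- Away from time `i` the added multiple of `z` is itself a zero-symbol branch, so it does not
  -- affect membership.
  have hmem : ∀ (s : ∀ j, T.S j) a j, (s j, a, s (j + 1)) ∈ (T.shear z φ).C j ↔
      (s j + φ i (s i) • z j, a, s (j + 1) + φ i (s i) • z (j + 1)) ∈ T.C j := by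
    intro s a j
    rw [mem_shear_C]
    by_cases hj : j = i
    · subst hj
      rw [hφ _ (ZMod.add_one_ne_self hn j), hzi]
      simp
    by_cases hj' : j + 1 = i
    · subst hj'
      rw [hφ _ hj, hzi]
      simp
    · rw [hφ _ hj, hφ _ hj']
      have h := (T.C j).smul_mem (φ i (s i)) (hz j hj hj')
      have h' := Submodule.add_mem_iff_left (T.C j) (x := (s j, a, s (j + 1))) h
      simpa using h'.symm
  refine isLocalReductionAt_and_dual_of_eq_comap
    (fun j => shearMap (φ j) (φ (j + 1)) (z j) (z (j + 1))) (fun j => shearMap_injective (hφz j))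
    (fun _ => rfl) le_rfl ⟨fun j _ => LinearEquiv.refl F (T.S j), ?_⟩ ?_
  · intro j hj hj' s a s'
    change _ ↔ (s + φ (j + 1) s' • z j, a, s' + φ j s • z (j + 1)) ∈ T.C j
    rw [hφ _ hj, hφ _ hj']
    simp
  · ext a
    rw [mem_code, mem_code]
    constructor
    · rintro ⟨s, hs⟩
      change ∀ j, T.S j at s
      exact ⟨fun j => s j + φ i (s i) • z j, fun j => (hmem s _ j).1 (hs j)⟩
    · rintro ⟨s, hs⟩
      -- This inverts the substitution: since `z i = 0`, the state at time `i`, hence the value of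
      -- `φ i`, is unchanged.
      refine ⟨fun j => s j - φ i (s i) • z j, fun j => (hmem (fun j => s j - φ i (s i) • z j) _ j).2 ?_⟩
      rw [hzi]
      simpa using hs j

/-- There is a strict local reduction, or a local reduction followed by a strict one, such that the
dual trellises are reduced in the same way. -/
def HasDualReduction (T : Trellis F n) : Prop :=
  (∃ (i : ZMod n) (T' : Trellis F n),
    IsStrictLocalReductionAt i T T' ∧ IsStrictLocalReductionAt i T.dual T'.dual) ∨
  (∃ (i j : ZMod n) (T' T'' : Trellis F n),
    (IsLocalReductionAt i T T' ∧ IsStrictLocalReductionAt j T' T'') ∧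
    (IsLocalReductionAt i T.dual T'.dual ∧ IsStrictLocalReductionAt j T'.dual T''.dual))

/-- Dualize the reduction of the dual; up to biduality the two requirements trade places. -/
theorem exists_isStrictLocalReductionAt_of_dual {T : Trellis F n}
    (h : ∃ (i : ZMod n) (T' : Trellis F n),
      IsStrictLocalReductionAt i T.dual T' ∧ IsStrictLocalReductionAt i T.dual.dual T'.dual) :
    ∃ (i : ZMod n) (T' : Trellis F n),
      IsStrictLocalReductionAt i T T' ∧ IsStrictLocalReductionAt i T.dual T'.dual := by
  obtain ⟨i, R, h1, h2⟩ := h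
  exact ⟨i, R.dual, h2.congr T.isIsomorphic_dual_dual (.refl _),
    h1.congr (.refl _) R.isIsomorphic_dual_dual⟩

theorem HasDualReduction.of_dual {T : Trellis F n} (h : T.dual.HasDualReduction) :
    T.HasDualReduction := by
  rcases h with h | ⟨i, j, R, R', ⟨h1, h2⟩, h3, h4⟩
  · exact Or.inl (exists_isStrictLocalReductionAt_of_dual h)
  · exact Or.inr ⟨i, j, R.dual, R'.dual,
      ⟨h3.congr T.isIsomorphic_dual_dual (.refl _), h4⟩,
      h1.congr (.refl _) R.isIsomorphic_dual_dual,
      h2.congr R.isIsomorphic_dual_dual.symm R'.isIsomorphic_dual_dual⟩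

theorem HasDualReduction.not_isLocallyIrreducible {T : Trellis F n} (h : T.HasDualReduction) :
    ¬ T.IsLocallyIrreducible := by
  intro hirr
  have hstrict : ∀ i T', ¬ IsStrictLocalReductionAt i T T' := fun i T' h =>
    absurd ((hirr i T' h.1).finrank_S i) h.2.ne'
  rcases h with ⟨i, T', h, -⟩ | ⟨i, j, T', T'', ⟨h1, h2⟩, -⟩
  · exact hstrict i T' h
  · exact hstrict j T'' (h2.congr (hirr i T' h1) (.refl _))

end Trellis

/-! ### Reducing a trellis that is not span-two-observable -/

/-- The chain `dim U ≤ dim C' ≤ dim C ≤ dim U` collapses. This shows that a shear which creates a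
kernel must lose surjectivity, that is, state-trimness. -/
theorem LinearMap.eq_zero_of_finrank_le_of_surjOn {F X U : Type*} [Field F]
    [AddCommGroup X] [Module F X] [FiniteDimensional F X]
    [AddCommGroup U] [Module F U] [FiniteDimensional F U] (π : X →ₗ[F] U) {C C' : Submodule F X}
    (h : Module.finrank F C' ≤ Module.finrank F C) (hinj : ∀ x ∈ C, π x = 0 → x = 0)
    (hsurj : ∀ u, ∃ x ∈ C', π x = u) : ∀ x ∈ C', π x = 0 → x = 0 := by
  have h1 : Function.Injective (π ∘ₗ C.subtype) := by
    rw [injective_iff_map_eq_zero]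
    exact fun x hx => Subtype.ext (hinj x x.2 hx)
  have h2 : Function.Surjective (π ∘ₗ C'.subtype) := fun u =>
    let ⟨x, hx, hu⟩ := hsurj u
    ⟨⟨x, hx⟩, hu⟩
  have h3 := LinearMap.finrank_le_finrank_of_injective h1
  have h4 := LinearMap.finrank_le_finrank_of_surjective h2
  have h5 : Function.Injective (π ∘ₗ C'.subtype) :=
    (LinearMap.injective_iff_surjective_of_finrank_eq_finrank (by omega)).2 h2
  intro x hx hπ
  exact congrArg Subtype.val ((injective_iff_map_eq_zero _).1 h5 ⟨x, hx⟩ hπ)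

namespace Trellis

variable {F : Type u} [Field F] {n : ℕ} [NeZero n]

section DualTrim

variable {T : Trellis F n}

/-- If the dual trellis is state-trim, then a zero path around the time axis is closed. -/
theorem eq_of_dual_isStateTrim (hd : T.dual.IsStateTrim) {m : ZMod n} {x : ∀ j, T.S j}
    {t : T.S (m + 1)} (hx : ∀ j, j ≠ m → (x j, (0 : F), x (j + 1)) ∈ T.C j)
    (ht : (x m, (0 : F), t) ∈ T.C m) : t = x (m + 1) := by
  rw [← sub_eq_zero, ← Module.forall_dual_apply_eq_zero_iff F]
  intro g
  obtain ⟨⟨b, γ⟩, hp, rfl⟩ := hd (m + 1) g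
  change ∀ j, Module.Dual F (T.S j) at γ
  have hγ : ∀ j s s', (s, (0 : F), s') ∈ T.C j → γ j s - γ (j + 1) s' = 0 := by
    intro j s s' h
    have := mem_dual_C.1 (hp j) _ _ _ h
    rwa [mul_zero, add_zero] at this
  -- A dual trajectory pairs to a constant with the states of a zero path, so only the term at the
  -- cut `m` survives.
  have h1 := sum_shift_sub_eq_zero fun j => γ j (x j)
  rw [Finset.sum_eq_single m (fun j _ hj => hγ j _ _ (hx j hj)) (by simp)] at h1
  have h2 := hγ m _ _ ht
  change γ (m + 1) (t - x (m + 1)) = 0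
  rw [map_sub]
  linear_combination h1 - h2

theorem eq_zero_of_dual_isStateTrim (hd : T.dual.IsStateTrim) {k : ZMod n} {x : ∀ j, T.S j}
    (hx : ∀ j, (x j, (0 : F), x (j + 1)) ∈ T.C j) (hk : x k = 0) (j : ZMod n) : x j = 0 := by
  have hstep : ∀ j, x j = 0 → x (j + 1) = 0 := by
    intro j hj
    refine (eq_of_dual_isStateTrim hd (m := j) (t := 0) (fun j _ => hx j) ?_).symm
    rw [hj]
    exact (T.C j).zero_mem
  obtain ⟨l, -, rfl⟩ := ZMod.exists_eq_add_natCast k j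
  induction l with
  | zero => rw [Nat.cast_zero, add_zero]; exact hk
  | succ l ih => rw [Nat.cast_succ, ← add_assoc]; exact hstep _ ih

theorem eq_zero_of_dual_isStateTrim_of_left (hd : T.dual.IsStateTrim) {m : ZMod n}
    {x : ∀ j, T.S j} (hx : ∀ j, j ≠ m → (x j, (0 : F), x (j + 1)) ∈ T.C j) (hm : x m = 0)
    (j : ZMod n) : x j = 0 := by
  have h0 : (x m, (0 : F), (0 : T.S (m + 1))) ∈ T.C m := by
    rw [hm]
    exact (T.C m).zero_mem
  have h1 : x (m + 1) = 0 := (eq_of_dual_isStateTrim hd hx h0).symm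
  refine eq_zero_of_dual_isStateTrim hd (fun j => ?_) hm j
  by_cases hj : j = m
  · subst hj
    rwa [h1]
  · exact hx j hj

theorem eq_zero_of_dual_isStateTrim_of_right (hn : 2 ≤ n) (hd : T.dual.IsStateTrim) {m : ZMod n}
    {x : ∀ j, T.S j} (hx : ∀ j, j ≠ m → (x j, (0 : F), x (j + 1)) ∈ T.C j) (hm : x (m + 1) = 0)
    (j : ZMod n) : x j = 0 := by
  obtain ⟨k, rfl⟩ : ∃ k, m = k + 1 := ⟨m - 1, by ring⟩
  have hk := ZMod.add_one_ne_self hn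
  -- Move the cut one step back: the path restarted with state `0` at `k + 1` arrives there in `x (k
  -- + 1)`, so closedness gives `x (k + 1) = 0`.
  have h1 : x (k + 1) = 0 := by
    have := eq_of_dual_isStateTrim hd (m := k) (x := Function.update x (k + 1) 0)
      (t := x (k + 1)) ?_ ?_
    · rwa [Function.update_self] at this
    · intro j hj
      by_cases hj' : j = k + 1
      · subst hj'
        rw [Function.update_self, Function.update_of_ne (hk _), hm]
        exact (T.C _).zero_mem
      · rw [Function.update_of_ne hj', Function.update_of_ne (fun h => hj (add_right_cancel h))]
        exact hx j hj'
    · rw [Function.update_of_ne (hk _).symm]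
      exact hx k (hk k).symm
  refine eq_zero_of_dual_isStateTrim hd (fun j => ?_) h1 j
  by_cases hj : j = k + 1
  · subst hj
    rw [h1, hm]
    exact (T.C _).zero_mem
  · exact hx j hj

/-- A forbidden branch, continued by zero states, runs once around the time axis without closing up.
-/
theorem isProper_of_dual_isStateTrim (hn : 2 ≤ n) (hd : T.dual.IsStateTrim) : T.IsProper := by
  intro i
  constructor
  · intro s hs
    obtain ⟨k, rfl⟩ : ∃ k, i = k + 1 := ⟨i - 1, by ring⟩
    have hk := ZMod.add_one_ne_self hn
    have := eq_of_dual_isStateTrim hd (m := k) (x := Pi.single (k + 1) s) (t := 0) ?_ ?_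
    · rw [Pi.single_eq_same] at this
      exact this.symm
    · intro j hj
      by_cases hj' : j = k + 1
      · subst hj'
        rw [Pi.single_eq_same, Pi.single_eq_of_ne (hk _)]
        exact hs
      · rw [Pi.single_eq_of_ne hj', Pi.single_eq_of_ne (fun h => hj (add_right_cancel h))]
        exact (T.C _).zero_mem
    · rw [Pi.single_eq_of_ne (hk _).symm]
      exact (T.C _).zero_mem
  · intro s' hs'
    exact eq_of_dual_isStateTrim hd (x := 0) (fun j _ => (T.C j).zero_mem) hs'

end DualTrim

/-- Taking `φ σ = 1` turns the branch `(z m, a, σ)` into `(0, a, σ)`. If `T.C m` projects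
injectively to its start states, this new kernel element costs surjectivity, so state-trimness
fails. Otherwise a branch `(0, b, τ)` with `b ≠ 0` allows `a` to be cancelled beforehand; the shear
then makes the trellis improper, so its dual is not state-trim. -/
theorem exists_shear_of_left (hn : 2 ≤ n) {T : Trellis F n} (hd : T.dual.IsStateTrim)
    {m : ZMod n} {z : ∀ j, T.S j} (hzm : z (m + 1) = 0) (hz0 : z ≠ 0)
    (hz : ∀ j, j ≠ m + 1 → j ≠ m → (z j, (0 : F), z (j + 1)) ∈ T.C j)
    {a : F} {σ : T.S (m + 1)} (hσ : (z m, a, σ) ∈ T.C m) (hσ0 : σ ≠ 0) :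
    ∃ φ : Module.Dual F (T.S (m + 1)), ¬ (T.shear z (Pi.single (m + 1) φ)).IsStateTrim ∨
      ¬ (T.shear z (Pi.single (m + 1) φ)).dual.IsStateTrim := by
  have hm : m ≠ m + 1 := (ZMod.add_one_ne_self hn m).symm
  have hshear : ∀ (φ : Module.Dual F (T.S (m + 1))) (b : F) (τ : T.S (m + 1)),
      (z m, b, τ) ∈ T.C m → φ τ = 1 →
      ((0 : T.S m), b, τ) ∈ (T.shear z (Pi.single (m + 1) φ)).C m := by
    intro φ b τ hτ hφ
    refine mem_shear_C.2 ?_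
    rw [Pi.single_eq_same, hφ]
    simpa using hτ
  have hprop := isProper_of_dual_isStateTrim hn hd m
  by_cases hinj : ∀ b τ, ((0 : T.S m), b, τ) ∈ T.C m → b = 0
  · obtain ⟨φ, hφ⟩ := Module.Projective.exists_dual_eq_one F hσ0
    refine ⟨φ, Or.inl fun htrim => hσ0 ?_⟩
    have h := LinearMap.eq_zero_of_finrank_le_of_surjOn (LinearMap.fst F (T.S m) (F × T.S (m + 1)))
      (C := T.C m) (C' := (T.shear z (Pi.single (m + 1) φ)).C m)
      (Submodule.finrank_comap_le_of_injective (shearMap_injective (by simp [hm])) _) ?_ ?_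
      _ (hshear φ a σ hσ hφ) rfl
    · exact congrArg (fun x => x.2.2) h
    · rintro ⟨s, b, τ⟩ hx hs
      obtain rfl : s = 0 := hs
      obtain rfl := hinj b τ hx
      rw [hprop.2 τ hx]
      rfl
    · intro u
      obtain ⟨p, hp, hu⟩ := htrim m u
      exact ⟨_, hp m, hu⟩
  · push Not at hinj
    obtain ⟨b, τ, hτ, hb⟩ := hinj
    have h1 : (z m, (0 : F), σ - (a / b) • τ) ∈ T.C m := by
      have := (T.C m).sub_mem hσ ((T.C m).smul_mem (a / b) hτ)
      simpa [div_mul_cancel₀ a hb] using this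
    have h2 : σ - (a / b) • τ ≠ 0 := by
      intro h0
      rw [h0] at h1
      refine hz0 (funext fun j => eq_zero_of_dual_isStateTrim_of_left hd (fun j hj => ?_) hzm j)
      by_cases hj' : j = m
      · subst hj'
        rwa [hzm]
      · exact hz j hj hj'
    obtain ⟨φ, hφ⟩ := Module.Projective.exists_dual_eq_one F h2
    exact ⟨φ, Or.inr fun htrim => h2
      ((isProper_of_dual_isStateTrim hn htrim m).2 _ (hshear φ 0 _ h1 hφ))⟩

/-- The mirror image of `exists_shear_of_left`, at the other end of the zero path. -/
theorem exists_shear_of_right (hn : 2 ≤ n) {T : Trellis F n} (hd : T.dual.IsStateTrim)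
    {m : ZMod n} {z : ∀ j, T.S j} (hzm : z (m + 1) = 0) (hz0 : z ≠ 0)
    (hz : ∀ j, j ≠ m + 1 → j ≠ m → (z j, (0 : F), z (j + 1)) ∈ T.C j)
    {a : F} {σ : T.S (m + 1)} (hσ : (σ, a, z (m + 1 + 1)) ∈ T.C (m + 1)) (hσ0 : σ ≠ 0) :
    ∃ φ : Module.Dual F (T.S (m + 1)), ¬ (T.shear z (Pi.single (m + 1) φ)).IsStateTrim ∨
      ¬ (T.shear z (Pi.single (m + 1) φ)).dual.IsStateTrim := by
  have hshear : ∀ (φ : Module.Dual F (T.S (m + 1))) (b : F) (τ : T.S (m + 1)),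
      (τ, b, z (m + 1 + 1)) ∈ T.C (m + 1) → φ τ = 1 →
      (τ, b, (0 : T.S (m + 1 + 1))) ∈ (T.shear z (Pi.single (m + 1) φ)).C (m + 1) := by
    intro φ b τ hτ hφ
    refine mem_shear_C.2 ?_
    rw [Pi.single_eq_same, hφ]
    simpa using hτ
  have hprop := isProper_of_dual_isStateTrim hn hd (m + 1)
  by_cases hinj : ∀ b τ, (τ, b, (0 : T.S (m + 1 + 1))) ∈ T.C (m + 1) → b = 0
  · obtain ⟨φ, hφ⟩ := Module.Projective.exists_dual_eq_one F hσ0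
    refine ⟨φ, Or.inl fun htrim => hσ0 ?_⟩
    have h := LinearMap.eq_zero_of_finrank_le_of_surjOn
      (LinearMap.snd F F (T.S (m + 1 + 1)) ∘ₗ LinearMap.snd F (T.S (m + 1)) (F × T.S (m + 1 + 1)))
      (C := T.C (m + 1)) (C' := (T.shear z (Pi.single (m + 1) φ)).C (m + 1))
      (Submodule.finrank_comap_le_of_injective (shearMap_injective (by simp [hzm])) _) ?_ ?_
      _ (hshear φ a σ hσ hφ) rfl
    · exact congrArg Prod.fst h
    · rintro ⟨τ, b, s⟩ hx hs
      obtain rfl : s = 0 := hs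
      obtain rfl := hinj b τ hx
      rw [hprop.1 τ hx]
      rfl
    · intro u
      obtain ⟨p, hp, hu⟩ := htrim (m + 1 + 1) u
      exact ⟨_, hp (m + 1), hu⟩
  · push Not at hinj
    obtain ⟨b, τ, hτ, hb⟩ := hinj
    have h1 : (σ - (a / b) • τ, (0 : F), z (m + 1 + 1)) ∈ T.C (m + 1) := by
      have := (T.C (m + 1)).sub_mem hσ ((T.C (m + 1)).smul_mem (a / b) hτ)
      simpa [div_mul_cancel₀ a hb] using this
    have h2 : σ - (a / b) • τ ≠ 0 := by
      intro h0
      rw [h0] at h1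
      refine hz0 (funext fun j =>
        eq_zero_of_dual_isStateTrim_of_right hn hd (m := m) (fun j hj => ?_) hzm j)
      by_cases hj' : j = m + 1
      · subst hj'
        rwa [hzm]
      · exact hz j hj' hj
    obtain ⟨φ, hφ⟩ := Module.Projective.exists_dual_eq_one F h2
    exact ⟨φ, Or.inr fun htrim => h2
      ((isProper_of_dual_isStateTrim hn htrim (m + 1)).1 _ (hshear φ 0 _ h1 hφ))⟩

theorem exists_isStrictLocalReductionAt_of_not_trim {T : Trellis F n}
    (h : ¬ T.IsStateTrim ∨ ¬ T.dual.IsStateTrim) :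
    ∃ (i : ZMod n) (T' : Trellis F n),
      IsStrictLocalReductionAt i T T' ∧ IsStrictLocalReductionAt i T.dual T'.dual :=
  h.elim exists_isStrictLocalReductionAt_of_not_isStateTrim fun h =>
    exists_isStrictLocalReductionAt_of_dual
      (exists_isStrictLocalReductionAt_of_not_isStateTrim h)

theorem hasDualReduction_of_not_isSpanTwoObservable (hn : 2 ≤ n) {T : Trellis F n}
    (hC : NoSpanTwoCodeword T.code) (hT : ¬ T.IsSpanTwoObservable) : T.HasDualReduction := by
  by_cases htrim : T.IsStateTrim
  swap
  · exact Or.inl (exists_isStrictLocalReductionAt_of_not_trim (Or.inl htrim))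
  by_cases hd : T.dual.IsStateTrim
  swap
  · exact Or.inl (exists_isStrictLocalReductionAt_of_not_trim (Or.inr hd))
  rw [isSpanTwoObservable_iff hn] at hT
  push Not at hT
  obtain ⟨m, s, hs, k, hk, hsk⟩ := hT
  obtain ⟨z, hzm, hz0, hz⟩ : ∃ z : ∀ j, T.S j, z (m + 1) = 0 ∧ z ≠ 0 ∧
      ∀ j, j ≠ m + 1 → j ≠ m → (z j, (0 : F), z (j + 1)) ∈ T.C j := by
    refine ⟨Function.update s (m + 1) 0, Function.update_self .., fun h => hsk ?_, ?_⟩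
    · have := congrFun h k
      rwa [Function.update_of_ne hk] at this
    · intro j hj hj'
      rw [Function.update_of_ne hj, Function.update_of_ne (fun h => hj' (add_right_cancel h))]
      exact hs j hj' hj
  have hm : m + 1 ≠ m := ZMod.add_one_ne_self hn m
  obtain ⟨a, σ, hσ⟩ : ∃ a σ, (z m, a, σ) ∈ T.C m := by
    obtain ⟨p, hp, hpm⟩ := htrim m (z m)
    exact ⟨_, _, hpm ▸ hp m⟩
  obtain ⟨b, σ', hσ'⟩ : ∃ b σ', (σ', b, z (m + 1 + 1)) ∈ T.C (m + 1) := by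
    obtain ⟨p, hp, hpm⟩ := htrim (m + 1 + 1) (z (m + 1 + 1))
    exact ⟨_, _, hpm ▸ hp (m + 1)⟩
  have key : ∃ φ : Module.Dual F (T.S (m + 1)),
      ¬ (T.shear z (Pi.single (m + 1) φ)).IsStateTrim ∨
        ¬ (T.shear z (Pi.single (m + 1) φ)).dual.IsStateTrim := by
    by_cases h1 : σ = 0
    swap
    · exact exists_shear_of_left hn hd hzm hz0 hz hσ h1
    by_cases h2 : σ' = 0
    swap
    · exact exists_shear_of_right hn hd hzm hz0 hz hσ' h2
    -- Now `z` is a trajectory with symbols `a`, `b` at `m`, `m + 1` and zero elsewhere. The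
    -- hypothesis on the code kills them, leaving a zero trajectory through the zero state at `m +
    -- 1`.
    exfalso
    subst h1 h2
    have hc : Function.update (Function.update (0 : ZMod n → F) m a) (m + 1) b ∈ T.code := by
      refine mem_code.2 ⟨z, fun j => ?_⟩
      by_cases hj : j = m + 1
      · subst hj
        rw [Function.update_self, hzm]
        exact hσ'
      by_cases hj' : j = m
      · subst hj'
        rw [Function.update_of_ne hj, Function.update_self, hzm]
        exact hσ
      · rw [Function.update_of_ne hj, Function.update_of_ne hj']
        exact hz j hj hj'
    have h0 := hC _ hc m 2 le_rfl ?_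
    · have ha : a = 0 := by
        have := congrFun h0 m
        rwa [Function.update_of_ne hm.symm, Function.update_self] at this
      subst ha
      refine hz0 (funext fun j => eq_zero_of_dual_isStateTrim_of_left hd (fun j hj => ?_) hzm j)
      by_cases hj' : j = m
      · subst hj'
        rwa [hzm]
      · exact hz j hj hj'
    · intro j hj
      by_cases h1 : j = m + 1
      · exact ⟨1, by norm_num, by simpa using h1⟩
      by_cases h2 : j = m
      · exact ⟨0, by norm_num, by simpa using h2⟩
      · simp [Function.update_of_ne h1, Function.update_of_ne h2] at hj
  obtain ⟨φ, hφ⟩ := key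
  obtain ⟨h1, h2⟩ := shear_isLocalReductionAt hn (φ := Pi.single (m + 1) φ) hzm
    (fun j hj hj' => hz j hj fun h => hj' (congrArg (· + 1) h))
    (fun j hj => by rw [Pi.single_eq_of_ne hj])
  obtain ⟨j, T'', h3, h4⟩ := exists_isStrictLocalReductionAt_of_not_trim hφ
  exact Or.inr ⟨m + 1, j, _, T'', ⟨h1, h3⟩, h2, h4⟩

end Trellis

/-! ### Local irreducibility from span-two-observability and span-two-controllability -/

/-- Two two-stage relations with the same composite, the first of which is trim and proper, and the
second of which has a middle space of at most the same dimension, coincide up to an isomorphism of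
the middle spaces. -/
theorem Submodule.exists_equiv_of_comp_eq {F P Q V V' : Type*} [Field F]
    [AddCommGroup P] [Module F P] [AddCommGroup Q] [Module F Q]
    [AddCommGroup V] [Module F V] [FiniteDimensional F V]
    [AddCommGroup V'] [Module F V'] [FiniteDimensional F V']
    {A : Submodule F (P × V)} {B : Submodule F (V × Q)}
    {A' : Submodule F (P × V')} {B' : Submodule F (V' × Q)}
    (hA : ∀ v, ∃ p, (p, v) ∈ A) (hB : ∀ v, ∃ q, (v, q) ∈ B)
    (hA0 : ∀ v, ((0 : P), v) ∈ A → v = 0) (hB0 : ∀ v, (v, (0 : Q)) ∈ B → v = 0)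
    (hcomp : ∀ p q, (∃ v, (p, v) ∈ A ∧ (v, q) ∈ B) ↔ ∃ v, (p, v) ∈ A' ∧ (v, q) ∈ B')
    (hdim : Module.finrank F V' ≤ Module.finrank F V) :
    ∃ θ : V ≃ₗ[F] V', (∀ p v, (p, v) ∈ A ↔ (p, θ v) ∈ A') ∧
      ∀ v q, (v, q) ∈ B ↔ (θ v, q) ∈ B' := by
  -- `R` relates middle states that occur between the same ends. Trimness makes it surject onto `V`,
  -- properness makes it inject into `V'`, and the dimension bound makes it the graph of `θ`.
  let R : Submodule F (V × V') :=
    { carrier := {x | ∃ p q, (p, x.1) ∈ A ∧ (x.1, q) ∈ B ∧ (p, x.2) ∈ A' ∧ (x.2, q) ∈ B'}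
      zero_mem' := ⟨0, 0, A.zero_mem, B.zero_mem, A'.zero_mem, B'.zero_mem⟩
      add_mem' := by
        rintro x y ⟨p, q, h1, h2, h3, h4⟩ ⟨p', q', h1', h2', h3', h4'⟩
        exact ⟨p + p', q + q', A.add_mem h1 h1', B.add_mem h2 h2', A'.add_mem h3 h3',
          B'.add_mem h4 h4'⟩
      smul_mem' := by
        rintro r x ⟨p, q, h1, h2, h3, h4⟩
        exact ⟨r • p, r • q, A.smul_mem r h1, B.smul_mem r h2, A'.smul_mem r h3,
          B'.smul_mem r h4⟩ }
  let f : R →ₗ[F] V := LinearMap.fst F V V' ∘ₗ R.subtype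
  let g : R →ₗ[F] V' := LinearMap.snd F V V' ∘ₗ R.subtype
  have hf : Function.Surjective f := by
    intro v
    obtain ⟨p, hp⟩ := hA v
    obtain ⟨q, hq⟩ := hB v
    obtain ⟨v', h1, h2⟩ := (hcomp p q).1 ⟨v, hp, hq⟩
    exact ⟨⟨(v, v'), p, q, hp, hq, h1, h2⟩, rfl⟩
  have hg : Function.Injective g := by
    rw [injective_iff_map_eq_zero]
    rintro ⟨⟨v, v'⟩, p, q, h1, h2, h3, h4⟩ h
    obtain rfl : v' = 0 := h
    obtain ⟨w, hw1, hw2⟩ := (hcomp p 0).2 ⟨0, h3, B'.zero_mem⟩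
    obtain rfl := hB0 w hw2
    have h5 : ((0 : P), v) ∈ A := by simpa using A.sub_mem h1 hw1
    obtain rfl := hA0 v h5
    rfl
  have h1 := LinearMap.finrank_le_finrank_of_surjective hf
  have h2 := LinearMap.finrank_le_finrank_of_injective hg
  have hf' : Function.Injective f :=
    (LinearMap.injective_iff_surjective_of_finrank_eq_finrank (by omega)).2 hf
  have hg' : Function.Surjective g :=
    (LinearMap.injective_iff_surjective_of_finrank_eq_finrank (by omega)).1 hg
  let θ : V ≃ₗ[F] V' :=
    (LinearEquiv.ofBijective f ⟨hf', hf⟩).symm.trans (LinearEquiv.ofBijective g ⟨hg, hg'⟩)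
  have hθ : ∀ x : R, θ (f x) = g x := by
    intro x
    have : (LinearEquiv.ofBijective f ⟨hf', hf⟩).symm (f x) = x :=
      (LinearEquiv.ofBijective f ⟨hf', hf⟩).symm_apply_apply x
    rw [LinearEquiv.trans_apply, this]
    rfl
  have hcross : ∀ p v q, (p, v) ∈ A → (v, q) ∈ B → (p, θ v) ∈ A' ∧ (θ v, q) ∈ B' := by
    intro p v q hp hq
    obtain ⟨v', h1, h2⟩ := (hcomp p q).1 ⟨v, hp, hq⟩
    have : θ v = v' := hθ ⟨(v, v'), p, q, hp, hq, h1, h2⟩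
    rw [this]
    exact ⟨h1, h2⟩
  have hcross' : ∀ p v q, (p, θ v) ∈ A' → (θ v, q) ∈ B' → (p, v) ∈ A ∧ (v, q) ∈ B := by
    intro p v q hp hq
    obtain ⟨w, h1, h2⟩ := (hcomp p q).2 ⟨θ v, hp, hq⟩
    have : θ w = θ v := hθ ⟨(w, θ v), p, q, h1, h2, hp, hq⟩
    rw [← θ.injective this]
    exact ⟨h1, h2⟩
  refine ⟨θ, fun p v => ⟨fun h => ?_, fun h => ?_⟩, fun v q => ⟨fun h => ?_, fun h => ?_⟩⟩
  · obtain ⟨q, hq⟩ := hB v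
    exact (hcross p v q h hq).1
  · obtain ⟨q, hq⟩ := hB v
    obtain ⟨p', hp'⟩ := hA v
    exact (hcross' p v q h (hcross p' v q hp' hq).2).1
  · obtain ⟨p, hp⟩ := hA v
    exact (hcross p v q hp h).2
  · obtain ⟨q', hq'⟩ := hB v
    obtain ⟨p, hp⟩ := hA v
    exact (hcross' p v q (hcross p v q' hp hq').1 h).2

theorem ZMod.add_two_ne_self {n : ℕ} (hn : 3 ≤ n) (j : ZMod n) : j + 1 + 1 ≠ j := by
  intro h
  have h2 : ((2 : ℕ) : ZMod n) = 0 := by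
    push_cast
    linear_combination h
  rw [ZMod.natCast_eq_zero_iff] at h2
  exact absurd (Nat.le_of_dvd (by norm_num) h2) (by omega)

namespace Trellis

variable {F : Type u} [Field F] {n : ℕ} [NeZero n]

theorem IsIsomorphic.isSpanTwoObservable (hn : 2 ≤ n) {T T' : Trellis F n} (h : IsIsomorphic T T')
    (hT : T.IsSpanTwoObservable) : T'.IsSpanTwoObservable := by
  rw [isSpanTwoObservable_iff hn] at hT ⊢
  obtain ⟨φ, hφ⟩ := isIsomorphic_iff.1 h.symm
  intro m s hs j hj
  have := hT m (fun j => φ j (s j)) (fun j hj hj' => (hφ _ _ _ _).1 (hs j hj hj')) j hj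
  simpa using this

theorem isSpanTwoControllable_dual_iff (hn : 2 ≤ n) {T : Trellis F n} :
    T.dual.IsSpanTwoControllable ↔ T.IsSpanTwoObservable :=
  ⟨T.isIsomorphic_dual_dual.symm.isSpanTwoObservable hn,
    T.isIsomorphic_dual_dual.isSpanTwoObservable hn⟩

section Controllable

variable {T : Trellis F n}

/-- In a span-two-controllable trellis, any two states at times `m + 2` and `m` are connected by a
path of length `n - 2`. -/
theorem IsSpanTwoControllable.exists_path (hn : 3 ≤ n) (hc : T.IsSpanTwoControllable) {m : ZMod n}
    (v : T.S m) (w : T.S (m + 1 + 1)) :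
    ∃ (a : ZMod n → F) (s : ∀ j, T.S j), s m = v ∧ s (m + 1 + 1) = w ∧
      ∀ j, j ≠ m → j ≠ m + 1 → (s j, a j, s (j + 1)) ∈ T.C j := by
  obtain ⟨k, rfl⟩ : ∃ k, m = k + 1 := ⟨m - 1, by ring⟩
  have hne1 := ZMod.add_one_ne_self (n := n) (by omega)
  have hne2 := ZMod.add_two_ne_self hn
  -- Dropping the constraints at `m` and `m + 1` makes the paths of length `n - 2` into
  -- trajectories. A functional on pairs of end states that kills them all yields a zero path in the
  -- dual.
  let T₁ : Trellis F n :=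
    { S := T.S, C := fun j => if j = k + 1 ∨ j = k + 1 + 1 then ⊤ else T.C j }
  have hT₁ : ∀ j, (j = k + 1 ∨ j = k + 1 + 1) → T₁.C j = ⊤ := fun j hj => if_pos hj
  have hT₁' : ∀ j, j ≠ k + 1 → j ≠ k + 1 + 1 → T₁.C j = T.C j := fun j hj hj' =>
    if_neg (not_or.2 ⟨hj, hj'⟩)
  let π : ((ZMod n → F) × (∀ j, T.S j)) →ₗ[F] (T.S (k + 1) × T.S (k + 1 + 1 + 1)) :=
    ((LinearMap.proj (k + 1)).prod (LinearMap.proj (k + 1 + 1 + 1))) ∘ₗ LinearMap.snd F _ _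
  suffices h : T₁.behavior.map π = ⊤ by
    have hmem : (v, w) ∈ T₁.behavior.map π := h ▸ Submodule.mem_top
    obtain ⟨⟨a, s⟩, hp, hvw⟩ := hmem
    refine ⟨a, s, congrArg Prod.fst hvw, congrArg Prod.snd hvw, fun j hj hj' => ?_⟩
    rw [← hT₁' j hj hj']
    exact hp j
  by_contra hlt
  obtain ⟨ω, hω0, hω⟩ := Submodule.exists_le_ker_of_lt_top _ (lt_top_iff_ne_top.2 hlt)
  obtain ⟨g, b, h, hy, hsum⟩ := T₁.exists_dual_branches (ω ∘ₗ π) fun p hp =>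
    hω (Submodule.mem_map_of_mem hp)
  change ∀ j, Module.Dual F (T.S j) at g
  change ∀ j, Module.Dual F (T.S (j + 1)) at h
  have hb : ∀ j, b j = 0 := by
    intro j
    rw [← sum_dual_branches_symbol (T := T₁) g b h j, ← hsum]
    exact map_zero ω
  have hgh : ∀ j (x : T.S (j + 1)), g (j + 1) x - h j x =
      ω ((Pi.single (j + 1) x : ∀ i, T.S i) (k + 1),
        (Pi.single (j + 1) x : ∀ i, T.S i) (k + 1 + 1 + 1)) := fun j x =>
    (sum_dual_branches_single (T := T₁) g b h j x).symm.trans (hsum _ _).symm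
  have htop : ∀ j, (j = k + 1 ∨ j = k + 1 + 1) → g j = 0 ∧ h j = 0 := by
    intro j hj
    have H : ∀ (s : T.S j) (a : F) (s' : T.S (j + 1)), g j s + b j * a - h j s' = 0 :=
      fun s a s' => mem_dual_C.1 (hy j) s a s' (by rw [hT₁ j hj]; trivial)
    constructor
    · ext s
      simpa using H s 0 0
    · ext s'
      simpa using H 0 0 s'
  -- The dual path ends in `h k`; the component of `g` at `k + 1` belongs to the unconstrained time
  -- and vanishes.
  have hzero := (isSpanTwoObservable_iff (by omega)).1 hc (k + 1) (Function.update g (k + 1) (h k))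
    fun j hj hj' => by
      have hyj : (g j, (0 : F), h j) ∈ T.dual.C j := by
        refine mem_dual_C.2 fun s a s' hs => ?_
        rw [← hT₁' j hj hj'] at hs
        have := mem_dual_C.1 (hy j) s a s' hs
        rwa [hb j] at this
      have hnext : (Function.update g (k + 1) (h k) : ∀ j, Module.Dual F (T.S j)) (j + 1) = h j := by
        by_cases hjk : j = k
        · subst hjk
          rw [Function.update_self]
        · have hj1 : j + 1 ≠ k + 1 := fun e => hjk (add_right_cancel e)
          have hj3 : j + 1 ≠ k + 1 + 1 + 1 := fun e => hj' (add_right_cancel e)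
          rw [Function.update_of_ne hj1]
          ext x
          have := hgh j x
          rw [Pi.single_eq_of_ne hj1.symm, Pi.single_eq_of_ne hj3.symm] at this
          rw [← sub_eq_zero, this]
          exact map_zero ω
      have hthis : (Function.update g (k + 1) (h k) : ∀ j, Module.Dual F (T.S j)) j = g j :=
        Function.update_of_ne hj ..
      exact (congrArg₂ (fun x y => ((x, (0 : F), y) : T.dual.S j × F × T.dual.S (j + 1)) ∈
        T.dual.C j) hthis hnext).mpr hyj
  have hx : h k = 0 :=
    (Function.update_self (k + 1) (h k) g).symm.trans (hzero (k + 1) (hne1 (k + 1)).symm)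
  have hw : g (k + 1 + 1 + 1) = 0 :=
    (Function.update_of_ne (hne2 (k + 1)) (h k) g).symm.trans (hzero _ (hne1 _))
  apply hω0
  refine LinearMap.prod_ext ?_ ?_
  · ext x
    have := hgh k x
    rw [hx, (htop _ (Or.inl rfl)).1, Pi.single_eq_same, Pi.single_eq_of_ne (hne2 _)] at this
    simpa using this.symm
  · ext x
    have := hgh (k + 1 + 1) x
    rw [hw, (htop _ (Or.inr rfl)).2, Pi.single_eq_same, Pi.single_eq_of_ne (hne2 _).symm] at this
    simpa using this.symm

theorem IsSpanTwoControllable.exists_branch_to (hn : 3 ≤ n) (hc : T.IsSpanTwoControllable)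
    {m : ZMod n} (σ : T.S (m + 1)) : ∃ s a, (s, a, σ) ∈ T.C m := by
  obtain ⟨a, s, h1, -, h⟩ := hc.exists_path hn σ 0
  have := h m (ZMod.add_one_ne_self (by omega) m).symm (ZMod.add_two_ne_self hn m).symm
  rw [h1] at this
  exact ⟨_, _, this⟩

theorem IsSpanTwoControllable.exists_branch_from (hn : 3 ≤ n) (hc : T.IsSpanTwoControllable)
    {m : ZMod n} (σ : T.S m) : ∃ a s', (σ, a, s') ∈ T.C m := by
  obtain ⟨k, rfl⟩ : ∃ k, m = k + 1 + 1 := ⟨m - 2, by ring⟩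
  obtain ⟨a, s, -, h1, h⟩ := hc.exists_path hn 0 σ
  have := h (k + 1 + 1) (ZMod.add_two_ne_self hn k) (ZMod.add_one_ne_self (by omega) _)
  rw [h1] at this
  exact ⟨_, _, this⟩

/-- In a span-two-controllable trellis, two consecutive branches lie on a valid trajectory. -/
theorem IsSpanTwoControllable.exists_trajectory (hn : 3 ≤ n) (hc : T.IsSpanTwoControllable)
    {m : ZMod n} {v : T.S m} {a : F} {σ : T.S (m + 1)} {b : F} {w : T.S (m + 1 + 1)}
    (h1 : (v, a, σ) ∈ T.C m) (h2 : (σ, b, w) ∈ T.C (m + 1)) :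
    ∃ (c : ZMod n → F) (s : ∀ j, T.S j), (∀ j, (s j, c j, s (j + 1)) ∈ T.C j) ∧
      s m = v ∧ c m = a ∧ s (m + 1) = σ ∧ c (m + 1) = b ∧ s (m + 1 + 1) = w := by
  obtain ⟨c, s, hv, hw, hs⟩ := hc.exists_path hn v w
  have hne := ZMod.add_one_ne_self (n := n) (by omega)
  have hm := (hne m).symm
  have hm' := hne (m + 1)
  refine ⟨Function.update (Function.update c m a) (m + 1) b, Function.update s (m + 1) σ,
    fun j => ?_, ?_, ?_, ?_, ?_, ?_⟩
  · by_cases hj : j = m + 1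
    · subst hj
      rwa [Function.update_self, Function.update_self, Function.update_of_ne hm', hw]
    by_cases hj' : j = m
    · subst hj'
      rwa [Function.update_self, Function.update_of_ne hm, Function.update_of_ne hm,
        Function.update_self, hv]
    · rw [Function.update_of_ne hj, Function.update_of_ne hj, Function.update_of_ne hj',
        Function.update_of_ne (fun e => hj' (add_right_cancel e))]
      exact hs j hj' hj
  · rwa [Function.update_of_ne hm]
  · rw [Function.update_of_ne hm, Function.update_self]
  · rw [Function.update_self]
  · rw [Function.update_self]
  · rwa [Function.update_of_ne hm']

theorem IsSpanTwoControllable.isBranchTrim (hn : 3 ≤ n) (hc : T.IsSpanTwoControllable) :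
    T.IsBranchTrim := by
  rintro i ⟨s, a, s'⟩ h
  obtain ⟨w, b, hw⟩ := hc.exists_branch_from hn s'
  obtain ⟨c, x, hx, h1, h2, h3, -, -⟩ := hc.exists_trajectory hn h hw
  exact ⟨(c, x), hx, Prod.ext h1 (Prod.ext h2 h3)⟩

theorem IsSpanTwoControllable.isStateTrim (hn : 3 ≤ n) (hc : T.IsSpanTwoControllable) :
    T.IsStateTrim := by
  intro i s
  obtain ⟨w, b, hw⟩ := hc.exists_branch_from hn s
  obtain ⟨p, hp, h⟩ := hc.isBranchTrim hn i _ hw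
  exact ⟨p, hp, congrArg Prod.fst h⟩

/-- The dual is span-two-controllable, hence state-trim, which forces properness. -/
theorem IsSpanTwoObservable.isProper (hn : 3 ≤ n) (ho : T.IsSpanTwoObservable) : T.IsProper :=
  isProper_of_dual_isStateTrim (by omega)
    (((isSpanTwoControllable_dual_iff (by omega)).2 ho).isStateTrim hn)

theorem trim_proper_spanTwo_iff (hn : 3 ≤ n) :
    (T.IsStateTrim ∧ T.IsBranchTrim ∧ T.IsProper ∧
      T.IsSpanTwoObservable ∧ T.IsSpanTwoControllable) ↔
      (T.IsSpanTwoObservable ∧ T.IsSpanTwoControllable) :=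
  ⟨fun h => h.2.2.2, fun h => ⟨h.2.isStateTrim hn, h.2.isBranchTrim hn, h.1.isProper hn, h⟩⟩

end Controllable

end Trellis

theorem exists_linearEquiv_update {ι F : Type*} [DecidableEq ι] [Semiring F] {V V' : ι → Type*}
    [∀ j, AddCommMonoid (V j)] [∀ j, Module F (V j)]
    [∀ j, AddCommMonoid (V' j)] [∀ j, Module F (V' j)]
    {i : ι} (e : ∀ j, j ≠ i → (V j ≃ₗ[F] V' j)) (θ : V i ≃ₗ[F] V' i) :
    ∃ φ : ∀ j, V j ≃ₗ[F] V' j, φ i = θ ∧ ∀ j h, φ j = e j h := by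
  refine ⟨fun j => if h : j = i then by subst h; exact θ else e j h, by simp, fun j h => ?_⟩
  simp [h]

namespace Trellis

variable {F : Type u} [Field F] {n : ℕ} [NeZero n]

section Irreducible

variable {T T' : Trellis F n} {m : ZMod n} {e : ∀ j, j ≠ m + 1 → (T.S j ≃ₗ[F] T'.S j)}

/-- Paths of length `n - 2` with the same symbols in a span-two-observable trellis and in a trellis
that coincides with it on their time interval have the same states. -/
theorem IsSpanTwoObservable.path_unique (hn : 2 ≤ n) (ho : T.IsSpanTwoObservable)
    (he : ∀ (j : ZMod n) (h : j ≠ m + 1) (h' : j + 1 ≠ m + 1) s a s',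
      (s, a, s') ∈ T.C j ↔ (e j h s, a, e (j + 1) h' s') ∈ T'.C j)
    {a : ZMod n → F} {s : ∀ j, T.S j} {s' : ∀ j, T'.S j}
    (hs : ∀ j, j ≠ m → j ≠ m + 1 → (s j, a j, s (j + 1)) ∈ T.C j)
    (hs' : ∀ j, j ≠ m → j ≠ m + 1 → (s' j, a j, s' (j + 1)) ∈ T'.C j)
    (j : ZMod n) (h : j ≠ m + 1) : e j h (s j) = s' j := by
  have hx := (isSpanTwoObservable_iff hn).1 ho m
    (fun j => if h : j ≠ m + 1 then s j - (e j h).symm (s' j) else 0) ?_ j h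
  · rw [dif_pos h, sub_eq_zero] at hx
    rw [hx, LinearEquiv.apply_symm_apply]
  · intro j hj hj'
    have hj1 : j + 1 ≠ m + 1 := fun h => hj (add_right_cancel h)
    rw [dif_pos hj', dif_pos hj1]
    have h1 : ((e j hj').symm (s' j), a j, (e (j + 1) hj1).symm (s' (j + 1))) ∈ T.C j := by
      rw [he j hj' hj1, LinearEquiv.apply_symm_apply, LinearEquiv.apply_symm_apply]
      exact hs' j hj hj'
    simpa using (T.C j).sub_mem (hs j hj hj') h1

/-- The two constraint codes changed in a local reduction of a span-two-observable and
span-two-controllable trellis have the same composite as before. -/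
theorem exists_state_iff_of_localReduction (hn : 3 ≤ n) (ho : T.IsSpanTwoObservable)
    (hc : T.IsSpanTwoControllable)
    (he : ∀ (j : ZMod n) (h : j ≠ m + 1) (h' : j + 1 ≠ m + 1) s a s',
      (s, a, s') ∈ T.C j ↔ (e j h s, a, e (j + 1) h' s') ∈ T'.C j)
    (hcode : T'.code = T.code) (hm : m ≠ m + 1) (hm' : m + 1 + 1 ≠ m + 1)
    (v : T.S m) (a b : F) (w : T.S (m + 1 + 1)) :
    (∃ σ, (v, a, σ) ∈ T.C m ∧ (σ, b, w) ∈ T.C (m + 1)) ↔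
      ∃ σ, (e m hm v, a, σ) ∈ T'.C m ∧ (σ, b, e (m + 1 + 1) hm' w) ∈ T'.C (m + 1) := by
  constructor
  · rintro ⟨σ, h1, h2⟩
    obtain ⟨c, s, hs, rfl, rfl, -, rfl, rfl⟩ := hc.exists_trajectory hn h1 h2
    have hmem : c ∈ T'.code := hcode ▸ mem_code.2 ⟨s, hs⟩
    obtain ⟨s', hs'⟩ := mem_code.1 hmem
    have huniq := ho.path_unique (by omega) he (fun j _ _ => hs j) (fun j _ _ => hs' j)
    rw [huniq, huniq]
    exact ⟨s' (m + 1), hs' m, hs' (m + 1)⟩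
  · rintro ⟨σ, h1, h2⟩
    -- Join the ends inside `T`, where the two trellises agree, and close up in `T'`. The resulting
    -- codeword has a trajectory in `T`, whose states off `m + 1` are forced by uniqueness.
    obtain ⟨c, s, rfl, rfl, hs⟩ := hc.exists_path hn v w
    obtain ⟨s', hσ, hs'⟩ : ∃ s' : ∀ j, T'.S j, s' (m + 1) = σ ∧ ∀ j h, s' j = e j h (s j) := by
      refine ⟨Function.update (fun j => if h : j ≠ m + 1 then e j h (s j) else 0) (m + 1) σ,
        Function.update_self .., fun j h => ?_⟩
      rw [Function.update_of_ne h, dif_pos h]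
    have hpath : ∀ j, (s' j, Function.update (Function.update c m a) (m + 1) b j, s' (j + 1)) ∈
        T'.C j := by
      intro j
      by_cases hj : j = m + 1
      · subst hj
        rwa [Function.update_self, hσ, hs' _ hm']
      by_cases hj' : j = m
      · subst hj'
        rwa [Function.update_of_ne hj, Function.update_self, hσ, hs' _ hm]
      · have hj1 : j + 1 ≠ m + 1 := fun h => hj' (add_right_cancel h)
        rw [Function.update_of_ne hj, Function.update_of_ne hj', hs' _ hj, hs' _ hj1, ← he]
        exact hs j hj' hj
    have hmem : Function.update (Function.update c m a) (m + 1) b ∈ T.code :=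
      hcode ▸ mem_code.2 ⟨s', hpath⟩
    obtain ⟨t, ht⟩ := mem_code.1 hmem
    have huniq : ∀ j, j ≠ m + 1 → t j = s j := by
      intro j hj
      have := ho.path_unique (by omega) he (fun j _ _ => ht j) (fun j _ _ => hpath j) j hj
      rw [hs' j hj] at this
      exact (e j hj).injective this
    refine ⟨t (m + 1), ?_, ?_⟩
    · have := ht m
      rwa [Function.update_of_ne hm, Function.update_self, huniq m hm] at this
    · have := ht (m + 1)
      rwa [Function.update_self, huniq _ hm'] at this

theorem isLocallyIrreducible_of_spanTwo (hn : 3 ≤ n) (ho : T.IsSpanTwoObservable)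
    (hc : T.IsSpanTwoControllable) : T.IsLocallyIrreducible := by
  intro i T' hred
  obtain ⟨hS, -, -, ⟨e, he⟩, hcode⟩ := isLocalReductionAt_iff.1 hred
  obtain ⟨m, rfl⟩ : ∃ m, i = m + 1 := ⟨i - 1, by ring⟩
  have hne := ZMod.add_one_ne_self (n := n) (by omega)
  have hm : m ≠ m + 1 := (hne m).symm
  have hm' : m + 1 + 1 ≠ m + 1 := hne (m + 1)
  have hcomp := exists_state_iff_of_localReduction hn ho hc he hcode hm hm'
  have hprop := ho.isProper hn
  -- The symbols are absorbed into the outer spaces, so only the state at `m + 1` is in the middle.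
  obtain ⟨θ, hθ, hθ'⟩ := Submodule.exists_equiv_of_comp_eq
    (P := T.S m × F) (Q := F × T.S (m + 1 + 1)) (V := T.S (m + 1)) (V' := T'.S (m + 1))
    (A := (T.C m).comap (LinearEquiv.prodAssoc F (T.S m) F (T.S (m + 1))).toLinearMap)
    (B := T.C (m + 1))
    (A' := (T'.C m).comap ((e m hm).toLinearMap.prodMap LinearMap.id ∘ₗ
      (LinearEquiv.prodAssoc F (T.S m) F (T'.S (m + 1))).toLinearMap))
    (B' := (T'.C (m + 1)).comap
      (LinearMap.id.prodMap (LinearMap.id.prodMap (e (m + 1 + 1) hm').toLinearMap)))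
    (fun σ => let ⟨s, a, h⟩ := hc.exists_branch_to hn σ; ⟨(s, a), h⟩)
    (fun σ => let ⟨a, s, h⟩ := hc.exists_branch_from hn σ; ⟨(a, s), h⟩)
    (fun σ h => (hprop m).2 σ h) (fun σ h => (hprop (m + 1)).1 σ h)
    (fun p q => hcomp p.1 p.2 q.1 q.2) hS
  obtain ⟨φ, hφ, hφ'⟩ := exists_linearEquiv_update e θ
  refine isIsomorphic_iff.2 ⟨φ, fun j s a s' => ?_⟩
  by_cases hj : j = m + 1
  · subst hj
    rw [hφ, hφ' _ hm']
    exact hθ' s (a, s')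
  by_cases hj' : j = m
  · subst hj'
    rw [hφ, hφ' _ hm]
    exact hθ (s, a) s'
  · have hj1 : j + 1 ≠ m + 1 := fun h => hj' (add_right_cancel h)
    rw [hφ' _ hj, hφ' _ hj1]
    exact he j hj hj1 s a s'

end Irreducible

/-! ### The equivalences -/

theorem hasDualReduction_of_not_spanTwo (hn : 2 ≤ n) {T : Trellis F n}
    (hC : NoSpanTwoCodeword T.code) (hC' : NoSpanTwoCodeword T.dual.code)
    (h : ¬ (T.IsSpanTwoObservable ∧ T.IsSpanTwoControllable)) : T.HasDualReduction := by
  rcases not_and_or.1 h with h | h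
  · exact hasDualReduction_of_not_isSpanTwoObservable hn hC h
  · exact (hasDualReduction_of_not_isSpanTwoObservable hn hC' h).of_dual

theorem isLocallyIrreducible_iff (hn : 3 ≤ n) {T : Trellis F n}
    (hC : NoSpanTwoCodeword T.code) (hC' : NoSpanTwoCodeword T.dual.code) :
    T.IsLocallyIrreducible ↔ T.IsSpanTwoObservable ∧ T.IsSpanTwoControllable := by
  refine ⟨fun h => ?_, fun h => isLocallyIrreducible_of_spanTwo hn h.1 h.2⟩
  by_contra h'
  exact (hasDualReduction_of_not_spanTwo (by omega) hC hC' h').not_isLocallyIrreducible h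

end Trellis

/-- For `n ≤ 2` every word has short support, so the code would be zero and its dual would contain
the all-one word. -/
theorem three_le_of_noSpanTwoCodeword {F : Type u} [Field F] {n : ℕ} [NeZero n]
    {C : Submodule F (ZMod n → F)} (hC : NoSpanTwoCodeword C)
    (hC' : NoSpanTwoCodeword (dualCode C)) : 3 ≤ n := by
  by_contra hn
  have huniv : ∀ c : ZMod n → F, Function.support c ⊆ circularInterval 0 2 := by
    intro c j _
    obtain ⟨k, hk, h⟩ := ZMod.exists_eq_add_natCast 0 j
    exact ⟨k, by omega, h⟩
  have h1 : (1 : ZMod n → F) ∈ dualCode C := by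
    intro x hx
    simp [hC x hx 0 2 le_rfl (huniv x)]
  have := congrFun (hC' 1 h1 0 2 le_rfl (huniv 1)) 0
  exact one_ne_zero this

theorem mainTheorem1 {F : Type u} [Field F] [Finite F] {n : ℕ} [NeZero n]
    (C : Submodule F (ZMod n → F))
    (hC : NoSpanTwoCodeword C) (hC' : NoSpanTwoCodeword (dualCode C))
    (T : Trellis F n) (hT : T.code = C) :
    List.TFAE
      [T.IsLocallyIrreducible,
       T.IsStateTrim ∧ T.IsBranchTrim ∧ T.IsProper ∧
         T.IsSpanTwoObservable ∧ T.IsSpanTwoControllable,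
       T.dual.IsLocallyIrreducible,
       T.dual.IsStateTrim ∧ T.dual.IsBranchTrim ∧ T.dual.IsProper ∧
         T.dual.IsSpanTwoObservable ∧ T.dual.IsSpanTwoControllable] ∧
    (¬ T.IsLocallyIrreducible →
      (∃ (i : ZMod n) (T' : Trellis F n),
        Trellis.IsStrictLocalReductionAt i T T' ∧
        Trellis.IsStrictLocalReductionAt i T.dual T'.dual) ∨
      (∃ (i j : ZMod n) (T' T'' : Trellis F n),
        (Trellis.IsLocalReductionAt i T T' ∧ Trellis.IsStrictLocalReductionAt j T' T'') ∧
        (Trellis.IsLocalReductionAt i T.dual T'.dual ∧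
          Trellis.IsStrictLocalReductionAt j T'.dual T''.dual))) := by
  have hn : 3 ≤ n := three_le_of_noSpanTwoCodeword hC hC'
  subst hT
  rw [← Trellis.code_dual] at hC'
  have hC'' : NoSpanTwoCodeword T.dual.dual.code := T.isIsomorphic_dual_dual.code_eq ▸ hC
  have h1 := Trellis.isLocallyIrreducible_iff hn hC hC'
  have h2 : T.dual.IsLocallyIrreducible ↔ T.IsSpanTwoObservable ∧ T.IsSpanTwoControllable := by
    rw [Trellis.isLocallyIrreducible_iff hn hC' hC'',
      Trellis.isSpanTwoControllable_dual_iff (by omega)]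
    exact and_comm
  refine ⟨?_, fun h =>
    Trellis.hasDualReduction_of_not_spanTwo (by omega) hC hC' fun h' => h (h1.2 h')⟩
  rw [Trellis.trim_proper_spanTwo_iff hn, Trellis.trim_proper_spanTwo_iff hn,
    ← Trellis.isLocallyIrreducible_iff hn hC' hC'', h2, h1]
  simp
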